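/- **Setting.** For every sample size $n$ let $p=p_n$ be the number of nodes, $\mathrm V=\{1,\dots,p\}$, $\mathcal E=\{(k,j)\in \mathrm V^2: k\ne j\}$. The data are $n$ i.i.d. copies of $X=(X_1,\dots,X_p)\sim P$ generated by the additive model $$X_j=\sum_{k\in\mathrm{pa}(j)}f^\star_{kj}(X_k)+\epsilon_j,\qquad \epsilon_j\sim\mathcal N(0,\sigma_j^{\star2})\ \text{mutually independent},\quad \sigma^\star_j>0,\quad \mathbb E f^\star_{kj}(X_k)=0,$$ on a DAG $\mathcal G^\star=(\mathrm V,E^\star)$ with $\mathrm{pa}(j)=\{k:(k,j)\in E^\star\}$ and $(k,j)\in E^\star\iff f^\star_{kj}\not\equiv0$; $s^\star=|E^\star|$. All quantities below may vary with $n$, except the constants $K,C,\eta,\overline\sigma,\underline c$. *Function classes.* For $(k,j)\in\mathcal E$ let $b_{rkj}$ $(r\ge1)$ be three times differentiable functions, let $$\mathcal F_{kj}=\Big\{\beta_0+\sum_{r\ge1}\beta_rb_{rkj}:\ \sum_{r\ge1}|\beta_r|r^\eta\le C,\ \beta_0=-\mathbb E\Big[\sum_{r\ge1}\beta_rb_{rkj}(X_k)\Big]\Big\},$$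 and assume $f^\star_{kj}\in\mathcal F_{kj}$. Let $R_n\ge1$ and let $\mathcal F_{kj,n}\subseteq\mathcal F_{kj}$ be the subclass with $\beta_r=0$ for $r>R_n$. For $g\subseteq \mathrm V\setminus\{j\}$ put $\nu_j(g)=\inf\{\mathbb E(X_j-\sum_{k\in g}f_{kj}(X_k))^2: f_{kj}\in\mathcal F_{kj}\}$. *Permutations.* A permutation $\pi$ of $\mathrm V$ is consistent with a DAG if an edge $\pi(a)\to\pi(b)$ forces $a<b$; $\Pi^\star$ is the set of permutations consistent with $\mathcal G^\star$. Given a super-structure $E^\circ$ with $E^\star\subseteq E^\circ\subseteq\mathcal E$, let $g(\pi)_j=\{k:(k,j)\in E^\circ,\ \pi^{-1}(k)<\pi^{-1}(j)\}$ and $$\xi_p=\min_{\pi\notin\Pi^\star}p^{-1}\sum_{j=1}^p\big(\log\nu_j(g(\pi)_j)-\log\sigma_j^{\star2}\big)\qquad(\min\varnothing=+\infty).$$ *Estimator.* Let $\lambda_n\geq 0$. The group-$\ell_0$ penalized maximum likelihood problem minimizes $$\sum_j\log\sigma_j^2+\sum_j\frac1{\sigma_j^2}\cdot\frac1n\sum_{i=1}^n\Big(X^{(i)}_j-\sum_{k\ne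 j}f_{kj}(X^{(i)}_k)\Big)^2+\lambda_n^2\,\big|\{(k,j)\in\mathcal E:\beta_{kj}\ne0\}\big|$$ over $\sigma_j>0$ and $f_{kj}=\beta_{0kj}+\sum_{r\le R_n}\beta_{rkj}b_{rkj}\in\mathcal F_{kj,n}$, where the graph $\{(k,j):\beta_{kj}\ne0\}$, $\beta_{kj}=(\beta_{1kj},\dots,\beta_{R_nkj})$, must be a DAG contained in $E^\circ$ with at most $s_n$ edges. The mixed-integer program minimizes, over $\Gamma_{jj},\Gamma_{j0},\Gamma_{jrk}\in\mathbb R$ (with $\Gamma_{jrj}=0$), $g_{kj}\in\{0,1\}$ (with $g_{jj}=0$) and $\psi\in[1,p]^p$, $$\sum_j-2\log\Gamma_{jj}+\sum_j\frac1n\sum_{i=1}^n\Big(\Gamma_{jj}X_j^{(i)}+\Gamma_{j0}+\sum_{k\neq j}\sum_{r\le R_n}\Gamma_{jrk}b_{rkj}(X_k^{(i)})\Big)^2+\lambda_n^2\sum_{(k,j)\in\mathcal E}g_{kj}$$ subject to $|\Gamma_{jrk}|\le Mg_{kj}$, $|\Gamma_{j0}|\le M\sum_kg_{kj}$, $0<\Gamma_{jj}\le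 M$, $1-p+pg_{kj}\le\psi_j-\psi_k$ for $(k,j)\in\mathcal E$, $g_{kj}=0$ for $(k,j)\notin E^\circ$, $\sum g_{kj}\le s_n$, and $\sum_{r\le R_n}|\beta_{rkj}|r^\eta\le C$, where $\beta_{rkj}=-\Gamma_{jrk}/\Gamma_{jj}$. Here $M$ is any constant that is at least the absolute values of the entries $1/\sigma_j^\star$, $\sum_k\beta_{0kj}^\star/\sigma^\star_j$, $\beta^\star_{rkj}/\sigma_j^\star$ $(r\le R_n)$ that encode the true model truncated to the first $R_n$ basis functions, for some coefficients $\beta^\star_{rkj}$ of the $f^\star_{kj}$ as in $\mathcal F_{kj}$ ($\beta^\star_{kj}=0$ if $(k,j)\notin E^\star$) and $\beta_{0kj}^\star=-\mathbb E[\sum_{r\le R_n}\beta^\star_{rkj}b_{rkj}(X_k)]$. For either problem, $\widehat\Pi$ is the set of permutations consistent with the estimated graph $\{(k,j):\beta_{kj}\ne0\}$ of an optimal solution. An early-stopped solution with threshold $\tau^{\rm early}$ is a feasible point whose objective value exceeds some lower bound for the optimal value by at most $\tau^{\rm early}$; $\widehat\Pi^{\rm early}$ is defined from its graph in the same way. **Theorem.**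 Assume that all non-zero $f^\star_{kj}$ are non-linear and three times differentiable, and: 1. $|\{k:(k,j)\in E^\circ\}|\le K$ for all $j$; 2. $s^\star\le s_n$; 3. $|b_{rkj}|\le1$, $\mathbb E[b_{rkj}(X_k)b_{r'kj}(X_k)]=\upsilon\mathbf 1(r=r')$ for some $\upsilon\in(0,1]$, and $\eta>1$; 4. $\sigma_j^{\star2}\le\overline\sigma^2$ and $\nu_j(g)\ge\underline c>0$ for all $j$ and all $g\subseteq\{k:(k,j)\in E^\circ\}$; 5. there is $\phi^2>0$ with $\mathbb E(\sum_{k\ne j}\gamma_kf_{kj}(X_k))^2\ge\phi^2\sum_{k\ne j}\gamma_k^2$ for all $j$, all $\gamma\in\mathbb R^p$ and all $f_{kj}\in\mathcal F_{kj}$ with $\mathbb E f_{kj}(X_k)^2=1$; 6. $\lambda_n^2s_n+p\sqrt{\log p/n}+s_nR_n^{-2\eta}=o(p\,\xi_p)$ as $n\to\infty$. Then there are events of probability at least $1-4/p$ for all sufficiently large $n$ such that, on these events and for all sufficiently large $n$: (1) $\widehat\Pi\subseteq\Pi^\star$ for every optimal solution; (2) if $\tau^{\rm early}=o(p\,\xi_p)$,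 then $\widehat\Pi^{\rm early}\subseteq\Pi^\star$ for every early-stopped solution (the events do not depend on $\tau^{\rm early}$; how large $n$ must be may). -/

import Mathlib

open MeasureTheory ProbabilityTheory Filter

noncomputable section

namespace CausalAdditive

/-! ### Directed graphs on `Fin p`; the pair `(k, j)` is the edge `k → j`. -/

/-- No directed cycle (in particular no self-loop). -/
def IsDAG {p : ℕ} (E : Finset (Fin p × Fin p)) : Prop :=
  ∀ v, ¬ Relation.TransGen (fun k j => (k, j) ∈ E) v v

/-- The permutations `π` consistent with `E`: an edge from `π a` to `π b` forces `a < b`. -/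
def consistentPerms {p : ℕ} (E : Finset (Fin p × Fin p)) : Set (Equiv.Perm (Fin p)) :=
  {π | ∀ a b, (π a, π b) ∈ E → a < b}

/-- The parents of `j` in `E`. -/
def parents {p : ℕ} (E : Finset (Fin p × Fin p)) (j : Fin p) : Finset (Fin p) :=
  Finset.univ.filter fun k => (k, j) ∈ E

/-- The candidate parents of `j` inside `S` that precede `j` in the ordering `π`. -/
def precedingParents {p : ℕ} (S : Finset (Fin p × Fin p)) (π : Equiv.Perm (Fin p)) (j : Fin p) :
    Finset (Fin p) :=
  Finset.univ.filter fun k => π.symm k < π.symm j ∧ (k, j) ∈ S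

/-! ### The model -/

/-- Additive structural equation model with independent Gaussian noise on a DAG: under the law `P`
of `X = (X_1, …, X_p)`, the noise variables `ε_j = X_j - ∑_{k ∈ pa(j)} f_{kj}(X_k)` are mutually
independent and `ε_j ∼ N(0, σ_j²)`. -/
structure CausalAdditiveModel (p : ℕ) where
  /-- the true edges -/
  E : Finset (Fin p × Fin p)
  isDAG : IsDAG E
  /-- `f k j` is the effect of node `k` on node `j` -/
  f : Fin p → Fin p → ℝ → ℝ
  mem_E_iff : ∀ k j, (k, j) ∈ E ↔ f k j ≠ 0
  /-- noise standard deviations -/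
  σ : Fin p → ℝ
  σ_pos : ∀ j, 0 < σ j
  /-- the law of `X` -/
  P : Measure (Fin p → ℝ)
  isProb : IsProbabilityMeasure P
  noise_indep : iIndepFun (fun (j : Fin p) (x : Fin p → ℝ) => x j - ∑ k ∈ parents E j, f k j (x k)) P
  noise_law : ∀ j, P.map (fun x => x j - ∑ k ∈ parents E j, f k j (x k)) =
    gaussianReal 0 (Real.toNNReal (σ j ^ 2))
  integrable_f : ∀ k j, Integrable (fun x => f k j (x k)) P
  integral_f : ∀ k j, ∫ x, f k j (x k) ∂P = 0

/-- `h` is three times differentiable. -/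
def ThreeTimesDifferentiable (h : ℝ → ℝ) : Prop :=
  ∀ m < 3, Differentiable ℝ (iteratedDeriv m h)

/-- Every non-zero `f_{kj}` is non-linear and three times differentiable. -/
def CausalAdditiveModel.Identifiable {p : ℕ} (m : CausalAdditiveModel p) : Prop :=
  ∀ k j, m.f k j ≠ 0 →
    (¬ ∃ a c : ℝ, ∀ x, m.f k j x = a * x + c) ∧ ThreeTimesDifferentiable (m.f k j)

/-! ### Function classes

`b r k j` is the basis function with index `r + 1` for the edge `(k, j)`; likewise for coefficients. -/

section

variable {p : ℕ} (b : ℕ → Fin p → Fin p → ℝ → ℝ) (P : Measure (Fin p → ℝ)) (C η : ℝ)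

/-- Conditions on the basis functions. -/
structure IsBoundedBasis : Prop where
  smooth : ∀ r k j, k ≠ j → ThreeTimesDifferentiable (b r k j)
  bounded : ∀ r k j, k ≠ j → ∀ x, |b r k j x| ≤ 1
  orthogonal : ∃ υ : ℝ, 0 < υ ∧ υ ≤ 1 ∧ ∀ k j, k ≠ j → ∀ r r',
    ∫ x, b r k j (x k) * b r' k j (x k) ∂P = if r = r' then υ else 0

/-- The coefficient sequence `β` satisfies `∑_{r ≥ 1} |β_r| r^η ≤ C`. -/
def InEllipsoid (β : ℕ → ℝ) : Prop :=
  Summable (fun r : ℕ => |β r| * ((r : ℝ) + 1) ^ η) ∧ ∑' r : ℕ, |β r| * ((r : ℝ) + 1) ^ η ≤ C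

/-- The function with coefficients `β`, with the intercept that gives it mean zero:
`-E[∑_r β_r b_{rkj}(X_k)] + ∑_r β_r b_{rkj}`. -/
def seriesFun (β : ℕ → ℝ) (k j : Fin p) (t : ℝ) : ℝ :=
  -(∫ x, ∑' r, β r * b r k j (x k) ∂P) + ∑' r, β r * b r k j t

/-- The class `F_{kj}`. -/
def classF (k j : Fin p) : Set (ℝ → ℝ) :=
  {f | ∃ β, InEllipsoid C η β ∧ f = seriesFun b P β k j}

/-- `ν_j(g)`: the residual variance of `X_j` after projection on `⨁_{k ∈ g} F_{kj}`. -/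
def residualVar (j : Fin p) (g : Finset (Fin p)) : ℝ :=
  sInf {v | ∃ f : Fin p → ℝ → ℝ, (∀ k ∈ g, f k ∈ classF b P C η k j) ∧
    v = ∫ x, (x j - ∑ k ∈ g, f k (x k)) ^ 2 ∂P}

/-- Functional compatibility. -/
def Compatible : Prop :=
  ∃ φ : ℝ, 0 < φ ^ 2 ∧ ∀ (γ : Fin p → ℝ) (j : Fin p) (f : Fin p → ℝ → ℝ),
    (∀ k, k ≠ j → f k ∈ classF b P C η k j ∧ ∫ x, f k (x k) ^ 2 ∂P = 1) →
    φ ^ 2 * ∑ k ∈ Finset.univ.erase j, γ k ^ 2 ≤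
      ∫ x, (∑ k ∈ Finset.univ.erase j, γ k * f k (x k)) ^ 2 ∂P

end

/-- The separation `ξ_p`, a minimum over the permutations not consistent with the true graph.
It takes values in `EReal`, so that it is `+∞` when there is no such permutation. -/
def separation {p : ℕ} (m : CausalAdditiveModel p) (b : ℕ → Fin p → Fin p → ℝ → ℝ) (C η : ℝ)
    (S : Finset (Fin p × Fin p)) : EReal :=
  ⨅ π : {π : Equiv.Perm (Fin p) // π ∉ consistentPerms m.E},
    (((p : ℝ)⁻¹ * ∑ j, (Real.log (residualVar b m.P C η j (precedingParents S π.1 j))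
      - Real.log (m.σ j ^ 2)) : ℝ) : EReal)

/-- `a_n = o(b_n)` for a real sequence `a` and an extended real sequence `b`. -/
def IsLittleOExt (a : ℕ → ℝ) (b : ℕ → EReal) : Prop :=
  ∀ c : ℝ, 0 < c → ∀ᶠ n in atTop, ((|a n| : ℝ) : EReal) ≤ (c : EReal) * b n

/-! ### Optimal and early-stopped solutions of a minimization problem -/

/-- `q` is a minimizer of `obj` over `feas`. -/
def IsOptimal {α : Type*} (feas : Set α) (obj : α → ℝ) (q : α) : Prop :=
  q ∈ feas ∧ ∀ q' ∈ feas, obj q ≤ obj q'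

/-- `q` is an incumbent at which branch-and-bound may stop with threshold `τ`: it is feasible, and
its objective value (the upper bound) exceeds some lower bound `L` for the whole problem by at
most `τ`. -/
def IsEarlyStopped {α : Type*} (feas : Set α) (obj : α → ℝ) (τ : ℝ) (q : α) : Prop :=
  q ∈ feas ∧ ∃ L : ℝ, (∀ q' ∈ feas, L ≤ obj q') ∧ obj q - L ≤ τ

/-! ### The estimators

A data set is `x : Fin n → Fin p → ℝ`, where `x i` is the `i`-th sample. Coefficients are
`β : Fin R → Fin p → Fin p → ℝ`, where `β r k j` belongs to `b r k j`. -/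

section

variable {n p R : ℕ}

/-- The graph of a coefficient array: `k → j` iff `∑_r |β_{rkj}|² ≠ 0`. -/
def coefGraph (β : Fin R → Fin p → Fin p → ℝ) : Finset (Fin p × Fin p) :=
  open Classical in
  Finset.univ.filter fun e => e.1 ≠ e.2 ∧ ∑ r, |β r e.1 e.2| ^ 2 ≠ 0

/-- The coefficients of every `f_{kj}` satisfy the constraint of the class `F_{kj}`. -/
def CoefBound (C η : ℝ) (β : Fin R → Fin p → Fin p → ℝ) : Prop :=
  ∀ k j, k ≠ j → ∑ r : Fin R, |β r k j| * ((r : ℝ) + 1) ^ η ≤ C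

/-- The mean-zero intercept `β_{0kj} = -E[∑_{r ≤ R} β_{rkj} b_{rkj}(X_k)]`. -/
def intercept (b : ℕ → Fin p → Fin p → ℝ → ℝ) (P : Measure (Fin p → ℝ))
    (β : Fin R → Fin p → Fin p → ℝ) (k j : Fin p) : ℝ :=
  -∫ x, ∑ r : Fin R, β r k j * b r k j (x k) ∂P

/-- `f_{kj} = β_{0kj} + ∑_{r ≤ R} β_{rkj} b_{rkj}`. -/
def truncFun (b : ℕ → Fin p → Fin p → ℝ → ℝ) (P : Measure (Fin p → ℝ))
    (β : Fin R → Fin p → Fin p → ℝ) (k j : Fin p) (t : ℝ) : ℝ :=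
  intercept b P β k j + ∑ r : Fin R, β r k j * b r k j t

/-! #### The group-`ℓ₀` penalized maximum likelihood problem -/

/-- A parameter: coefficients and noise standard deviations. -/
structure MLEPoint (p R : ℕ) where
  β : Fin R → Fin p → Fin p → ℝ
  σ : Fin p → ℝ

/-- Feasible parameters: edges inside the super-structure `S`, at most `s` of them. -/
def mleFeasible (C η : ℝ) (S : Finset (Fin p × Fin p)) (s : ℝ) : Set (MLEPoint p R) :=
  {θ | (∀ j, 0 < θ.σ j) ∧ IsDAG (coefGraph θ.β) ∧ CoefBound C η θ.β ∧
    coefGraph θ.β ⊆ S ∧ ((coefGraph θ.β).card : ℝ) ≤ s}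

/-- `∑_j log σ_j² + ∑_j ‖X_j - ∑_{k ≠ j} f_{kj}(X_k)‖_n² / σ_j² + λ² · #edges`. -/
def mleObjective (b : ℕ → Fin p → Fin p → ℝ → ℝ) (P : Measure (Fin p → ℝ)) (lam : ℝ)
    (x : Fin n → Fin p → ℝ) (θ : MLEPoint p R) : ℝ :=
  ∑ j, Real.log (θ.σ j ^ 2)
    + ∑ j, ((n : ℝ)⁻¹ * ∑ i, (x i j - ∑ k ∈ Finset.univ.erase j, truncFun b P θ.β k j (x i k)) ^ 2)
        / θ.σ j ^ 2
    + lam ^ 2 * ((coefGraph θ.β).card : ℝ)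

/-! #### The convex mixed-integer program -/

/-- Column index of `Γ`: the block of `X_1, …, X_p`, the intercept, the block of all
`b_{rkj}(X_k)`. -/
abbrev Col (p R : ℕ) := Fin p ⊕ (Unit ⊕ (Fin R × Fin p))

/-- The column of the variable `X_k`. -/
abbrev colX (R : ℕ) {p : ℕ} (k : Fin p) : Col p R := Sum.inl k

/-- The column of the intercept. -/
abbrev colOne (p R : ℕ) : Col p R := Sum.inr (Sum.inl ())

/-- The column of the `r`-th basis function of `X_k`. -/
abbrev colB {p R : ℕ} (r : Fin R) (k : Fin p) : Col p R := Sum.inr (Sum.inr (r, k))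

/-- `Γ = diag(σ)⁻¹ [I, -B⁽⁰⁾, -B⁽¹⁾, …, -B⁽ᴿ⁾]`. -/
def gammaOf (σ : Fin p → ℝ) (β₀ : Fin p → ℝ) (β : Fin R → Fin p → Fin p → ℝ) :
    Matrix (Fin p) (Col p R) ℝ := fun j c =>
  (σ j)⁻¹ * match c with
    | Sum.inl k => if k = j then 1 else 0
    | Sum.inr (Sum.inl _) => -β₀ j
    | Sum.inr (Sum.inr (r, k)) => -β r k j

/-- The coefficients `β_{rkj} = -Γ_{j,(r,k)} / Γ_{jj}` encoded by `Γ`. -/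
def betaOf (Γ : Matrix (Fin p) (Col p R) ℝ) (r : Fin R) (k j : Fin p) : ℝ :=
  -Γ j (colB r k) / Γ j (colX R j)

/-- The extended basis vector for the regression of node `j`. -/
def extVec (R : ℕ) (b : ℕ → Fin p → Fin p → ℝ → ℝ) (j : Fin p) (x : Fin p → ℝ) : Col p R → ℝ
  | Sum.inl k => x k
  | Sum.inr (Sum.inl _) => 1
  | Sum.inr (Sum.inr (r, k)) => b r k j (x k)

/-- The Gram matrix of the extended basis vectors for node `j`. -/
def gram (R : ℕ) (b : ℕ → Fin p → Fin p → ℝ → ℝ) (x : Fin n → Fin p → ℝ) (j : Fin p) :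
    Matrix (Col p R) (Col p R) ℝ :=
  (n : ℝ)⁻¹ • ∑ i, Matrix.vecMulVec (extVec R b j (x i)) (extVec R b j (x i))

/-- Decision variables: scaled coefficients `Γ`, edge indicators `g`, layer values `ψ`. -/
structure MIPPoint (p R : ℕ) where
  Γ : Matrix (Fin p) (Col p R) ℝ
  g : Fin p → Fin p → ℝ
  ψ : Fin p → ℝ

/-- Feasible points of the program with big-`M` constant `M`, super-structure `S`, at most `s`
edges, and coefficients in the function classes. -/
structure MIPFeasible (C η : ℝ) (S : Finset (Fin p × Fin p)) (s M : ℝ) (q : MIPPoint p R) :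
    Prop where
  g_binary : ∀ k j, q.g k j = 0 ∨ q.g k j = 1
  g_diag : ∀ j, q.g j j = 0
  ψ_range : ∀ j, 1 ≤ q.ψ j ∧ q.ψ j ≤ p
  Γ_offdiag : ∀ j k, k ≠ j → q.Γ j (colX R k) = 0
  Γ_self : ∀ j r, q.Γ j (colB r j) = 0
  bigM_coef : ∀ k j, k ≠ j → ∀ r,
    -M * q.g k j ≤ q.Γ j (colB r k) ∧ q.Γ j (colB r k) ≤ M * q.g k j
  bigM_intercept : ∀ j,
    -M * ∑ k, q.g k j ≤ q.Γ j (colOne p R) ∧ q.Γ j (colOne p R) ≤ M * ∑ k, q.g k j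
  bigM_diag : ∀ j, 0 < q.Γ j (colX R j) ∧ q.Γ j (colX R j) ≤ M
  layer : ∀ k j, k ≠ j → 1 - (p : ℝ) + p * q.g k j ≤ q.ψ j - q.ψ k
  super : ∀ k j, (k, j) ∉ S → q.g k j = 0 ∧ ∀ r, q.Γ j (colB r k) = 0
  card_le : ∑ k, ∑ j, q.g k j ≤ s
  coef : CoefBound C η (betaOf q.Γ)

/-- `∑_j -2 log Γ_{jj} + ∑_j Γ_j Σ̂_j Γ_jᵀ + λ² ∑ g_{kj}`. When the basis functions do not depend
on `j`, all `Σ̂_j` are one matrix `Σ̂` and the middle term is `tr(Γᵀ Γ Σ̂)`. -/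
def mipObjective (b : ℕ → Fin p → Fin p → ℝ → ℝ) (lam : ℝ) (x : Fin n → Fin p → ℝ)
    (q : MIPPoint p R) : ℝ :=
  ∑ j, -2 * Real.log (q.Γ j (colX R j))
    + ∑ j, q.Γ j ⬝ᵥ (gram R b x j).mulVec (q.Γ j)
    + lam ^ 2 * ∑ k, ∑ j, q.g k j

/-- The constant `M` bounds the entries of the matrix `Γ` that encodes the true model, truncated
to the first `R` basis functions. -/
def IsBigM (m : CausalAdditiveModel p) (b : ℕ → Fin p → Fin p → ℝ → ℝ) (C η : ℝ) (R : ℕ) (M : ℝ) :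
    Prop :=
  ∃ β : ℕ → Fin p → Fin p → ℝ,
    (∀ k j, (k, j) ∈ m.E → InEllipsoid C η (fun r => β r k j) ∧
      m.f k j = seriesFun b m.P (fun r => β r k j) k j) ∧
    (∀ k j, (k, j) ∉ m.E → ∀ r, β r k j = 0) ∧
    ∀ j c, |gammaOf m.σ
      (fun j => ∑ k, intercept b m.P (fun (r : Fin R) k j => β r k j) k j)
      (fun (r : Fin R) k j => β r k j) j c| ≤ M

end

end CausalAdditive

end

open CausalAdditive

/-! The argument compares likelihoods on one event where all empirical second moments are uniformly
accurate.

Probabilistic part. For each node the features are the constant, the noise `ε_j`, and the centred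
basis functions of the other variables. A residual `X_j - ∑ f_k(X_k)` with at most `K` functions
from the classes is an absolutely convergent series in these features, and its coefficients,
weighted by `r`, have `ℓ₁` norm at most `1 + 2KC`. Hence a bound `A r r'` on the deviation of the
empirical mean of each product of two features bounds the deviation of every residual second moment
by `A (1 + 2KC)²`, whatever the truncation level; no entropy argument is needed. All products have
the sub-exponential envelope `(2 + |ε_j|)²`, with constants depending only on `σbar`. Bernstein's
inequality with threshold proportional to `r r'` gives geometrically decaying tails, so a union
bound over infinitely many features costs no more than one over pairs of variables
(`measureReal_compl_goodSamples_le`). This yields `A` of order `√(log p / n)`. The event involves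
neither the threshold of early stopping nor the penalty.

Deterministic part. Minimizing over the scale of node `j` leaves `1 + log` of its empirical residual
variance. For a feasible graph consistent with `π`, that variance is at least `ν_j` of the candidate
parents preceding `j`, up to the deviation. The truncated true model is feasible, and its value is
at most `∑ (1 + log σ_j²)` plus the deviation, the truncation bias and the penalty. The bias is
quadratic because the noise is uncorrelated with functions of the parents. Subtracting gives the
basic inequality `Regular.orderGap_le`: the total log-variance gap of `π` is bounded by a constant
multiple of the error terms, plus the stopping threshold. For an inconsistent `π` the gap is at
least `p ξ_p`, which dominates all of these (`Regular.not_orderGap_le`).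

The mixed-integer program is the same problem in scaled coordinates with a free intercept at each
node. A free intercept lowers the empirical variance by at most the squared empirical mean of the
residual, which is also controlled because the constant is a feature.

Smallness of `log p / n` is not assumed separately: the gap of any ordering is at most a constant
times `p`, so it follows from the separation condition once some ordering is wrong. If the true
graph is empty, every ordering is right and nothing has to be shown. -/

namespace CausalAdditive

/-! ### Concentration of empirical means -/

section Concentration

variable {X : Type*} [MeasurableSpace X] {n : ℕ}

/-- The deviation of the empirical mean of `u` from its expectation. -/
noncomputable def empDev (P : Measure X) (x : Fin n → X) (u : X → ℝ) : ℝ :=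
  (n : ℝ)⁻¹ * ∑ i, u (x i) - ∫ y, u y ∂P

theorem exp_le_one_add_add_sq_mul_exp_abs (x : ℝ) :
    Real.exp x ≤ 1 + x + x ^ 2 * Real.exp |x| := by
  have h := Complex.norm_exp_sub_sum_le_norm_mul_exp (x : ℂ) 2
  rw [← Complex.ofReal_exp] at h
  simp only [Finset.sum_range_succ, Finset.range_zero, Finset.sum_empty, pow_zero, pow_one,
    Nat.factorial_zero, Nat.factorial_one, Nat.cast_one, div_one, zero_add] at h
  have e : (Real.exp x : ℂ) - (1 + x) = ((Real.exp x - (1 + x) : ℝ) : ℂ) := by push_cast; ring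
  rw [e, Complex.norm_real, Complex.norm_real, Real.norm_eq_abs, Real.norm_eq_abs, sq_abs] at h
  linarith [le_abs_self (Real.exp x - (1 + x))]

variable {P : Measure X} {Y V : X → ℝ} {t₀ t B : ℝ}

theorem integrable_of_exp_envelope (hY : Measurable Y) (hYV : ∀ x, |Y x| ≤ V x) (ht₀ : 0 < t₀)
    (hV : Integrable (fun x => Real.exp (t₀ * V x)) P) : Integrable Y P := by
  refine (hV.const_mul t₀⁻¹).mono' hY.aestronglyMeasurable (Eventually.of_forall fun x => ?_)
  rw [Real.norm_eq_abs, inv_mul_eq_div, le_div_iff₀ ht₀]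
  have := Real.add_one_le_exp (t₀ * V x)
  nlinarith [hYV x]

theorem integrable_exp_mul_of_envelope (hY : Measurable Y) (hYV : ∀ x, |Y x| ≤ V x)
    (ht : |t| ≤ t₀) (hV : Integrable (fun x => Real.exp (t₀ * V x)) P) :
    Integrable (fun x => Real.exp (t * Y x)) P := by
  refine hV.mono' (by fun_prop) (Eventually.of_forall fun x => ?_)
  rw [Real.norm_eq_abs, Real.abs_exp]
  refine Real.exp_le_exp.2 ((le_abs_self _).trans ?_)
  rw [abs_mul]
  exact mul_le_mul ht (hYV x) (abs_nonneg _) ((abs_nonneg t).trans ht)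

theorem empDev_neg (x : Fin n → X) (u : X → ℝ) : empDev P x (fun y => -u y) = -empDev P x u := by
  simp only [empDev, Finset.sum_neg_distrib, integral_neg]
  ring

/-- The samples on which the empirical means of all products of two features of the same node
deviate from their expectations by at most `A` times the product of the weights. -/
def goodSamples {J T : Type*} (P : Measure X) (n : ℕ) (φ : J → T × ℕ → X → ℝ) (A : ℝ) :
    Set (Fin n → X) :=
  {x | ∀ j a a', |empDev P x fun y => φ j a y * φ j a' y| ≤
    A * (((a.2 : ℝ) + 1) * ((a'.2 : ℝ) + 1))}

theorem measurable_empDev {u : X → ℝ} (hu : Measurable u) :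
    Measurable fun x : Fin n → X => empDev P x u := by
  unfold empDev
  fun_prop

theorem measurableSet_goodSamples {J T : Type*} [Countable J] [Countable T]
    {φ : J → T × ℕ → X → ℝ} (hφ : ∀ j a, Measurable (φ j a)) (A : ℝ) :
    MeasurableSet (goodSamples P n φ A) := by
  simp only [goodSamples, Set.ofPred_forall]
  refine MeasurableSet.iInter fun j => MeasurableSet.iInter fun a => MeasurableSet.iInter fun a' =>
    measurableSet_le ?_ measurable_const
  exact (measurable_empDev ((hφ j a).mul (hφ j a'))).abs

variable [IsProbabilityMeasure P]

/-- A sub-exponential bound on the moment generating function. -/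
theorem integral_exp_mul_le (hY : Measurable Y) (hYV : ∀ x, |Y x| ≤ V x) (ht₀ : 0 < t₀)
    (ht : |t| ≤ t₀ / 2) (hV : Integrable (fun x => Real.exp (t₀ * V x)) P)
    (hB : ∫ x, Real.exp (t₀ * V x) ∂P ≤ B) :
    ∫ x, Real.exp (t * Y x) ∂P ≤ Real.exp (t * ∫ x, Y x ∂P + 8 * B / t₀ ^ 2 * t ^ 2) := by
  have hYi := integrable_of_exp_envelope hY hYV ht₀ hV
  have hpt : ∀ x, Real.exp (t * Y x) ≤
      1 + t * Y x + 8 / t₀ ^ 2 * t ^ 2 * Real.exp (t₀ * V x) := by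
    intro x
    refine (exp_le_one_add_add_sq_mul_exp_abs _).trans ?_
    have hV0 : 0 ≤ V x := (abs_nonneg _).trans (hYV x)
    have h1 : |t * Y x| ≤ t₀ / 2 * V x := by
      rw [abs_mul]; exact mul_le_mul ht (hYV x) (abs_nonneg _) (by positivity)
    have h2 : Real.exp |t * Y x| ≤ Real.exp (t₀ / 2 * V x) := Real.exp_le_exp.2 h1
    -- Half of the exponential rate pays for the square of the envelope, by `y²/2 ≤ exp y` at `y =
    -- t₀ V / 2`; the other half dominates `exp |tY|`. Together they use exactly `exp (t₀ V)`.
    have h3 : V x ^ 2 ≤ 8 / t₀ ^ 2 * Real.exp (t₀ / 2 * V x) := by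
      have := Real.quadratic_le_exp_of_nonneg (x := t₀ / 2 * V x) (by positivity)
      rw [div_mul_eq_mul_div, le_div_iff₀ (by positivity)]
      nlinarith [mul_nonneg ht₀.le hV0]
    have h4 : (t * Y x) ^ 2 ≤ t ^ 2 * V x ^ 2 := by
      rw [mul_pow]
      exact mul_le_mul_of_nonneg_left (sq_le_sq' (by linarith [neg_abs_le (Y x), hYV x])
        ((le_abs_self _).trans (hYV x))) (sq_nonneg t)
    have h5 : Real.exp (t₀ * V x) = Real.exp (t₀ / 2 * V x) * Real.exp (t₀ / 2 * V x) := by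
      rw [← Real.exp_add]; ring_nf
    have h6 : (t * Y x) ^ 2 * Real.exp |t * Y x| ≤
        t ^ 2 * (8 / t₀ ^ 2 * Real.exp (t₀ / 2 * V x)) * Real.exp (t₀ / 2 * V x) :=
      mul_le_mul (h4.trans (mul_le_mul_of_nonneg_left h3 (sq_nonneg t))) h2
        (Real.exp_pos _).le (by positivity)
    rw [h5]
    linarith
  have hinteg₁ : Integrable (fun x => 1 + t * Y x) P := (integrable_const _).add (hYi.const_mul t)
  have hinteg : Integrable (fun x => 1 + t * Y x + 8 / t₀ ^ 2 * t ^ 2 * Real.exp (t₀ * V x)) P :=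
    hinteg₁.add (hV.const_mul _)
  have hle := integral_mono
    (integrable_exp_mul_of_envelope hY hYV (ht.trans (by linarith)) hV) hinteg hpt
  refine hle.trans ?_
  rw [integral_add hinteg₁ (hV.const_mul _),
    integral_add (integrable_const _) (hYi.const_mul t), integral_const_mul, integral_const_mul]
  simp only [integral_const, probReal_univ, smul_eq_mul, mul_one]
  have h7 : 8 / t₀ ^ 2 * t ^ 2 * ∫ x, Real.exp (t₀ * V x) ∂P ≤ 8 / t₀ ^ 2 * t ^ 2 * B :=
    mul_le_mul_of_nonneg_left hB (by positivity)
  have h8 := Real.add_one_le_exp (t * ∫ x, Y x ∂P + 8 * B / t₀ ^ 2 * t ^ 2)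
  have h9 : 8 / t₀ ^ 2 * t ^ 2 * B = 8 * B / t₀ ^ 2 * t ^ 2 := by ring
  linarith

/-- Chernoff's method: exponential Markov for the sum, whose moment generating function factorizes
over the independent samples. The rate `t` stays free so that it can be tuned once for all products
of features. -/
theorem measureReal_le_empDev_le (hn : 0 < n) (hY : Measurable Y) (hYV : ∀ x, |Y x| ≤ V x)
    (ht₀ : 0 < t₀) (ht0 : 0 ≤ t) (ht : t ≤ t₀ / 2)
    (hV : Integrable (fun x => Real.exp (t₀ * V x)) P)
    (hB : ∫ x, Real.exp (t₀ * V x) ∂P ≤ B) (u : ℝ) :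
    (Measure.pi fun _ : Fin n => P).real {x | u ≤ empDev P x Y} ≤
      Real.exp (n * (8 * B / t₀ ^ 2 * t ^ 2 - t * u)) := by
  have hn' : (0 : ℝ) < n := Nat.cast_pos.2 hn
  have habs : |t| ≤ t₀ / 2 := by rwa [abs_of_nonneg ht0]
  have hset : {x : Fin n → X | u ≤ empDev P x Y} =
      {x | n * (u + ∫ y, Y y ∂P) ≤ ∑ i, Y (x i)} := by
    ext x
    simp only [empDev, Set.mem_ofPred_eq, le_sub_iff_add_le, inv_mul_eq_div, le_div_iff₀ hn']
    rw [mul_comm]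
  have hexp : (fun x : Fin n → X => Real.exp (t * ∑ i, Y (x i))) =
      fun x => ∏ i, Real.exp (t * Y (x i)) := by
    funext x; rw [Finset.mul_sum, Real.exp_sum]
  have hinteg : Integrable (fun x : Fin n → X => Real.exp (t * ∑ i, Y (x i)))
      (Measure.pi fun _ : Fin n => P) := by
    rw [hexp]
    exact Integrable.fintype_prod fun _ =>
      integrable_exp_mul_of_envelope hY hYV (habs.trans (by linarith)) hV
  have hmgf : mgf (fun x : Fin n → X => ∑ i, Y (x i)) (Measure.pi fun _ : Fin n => P) t ≤
      Real.exp (n * (t * ∫ x, Y x ∂P + 8 * B / t₀ ^ 2 * t ^ 2)) := by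
    rw [mgf, hexp, integral_fintype_prod_eq_pow (fun x => Real.exp (t * Y x)), Fintype.card_fin,
      Real.exp_nat_mul]
    exact pow_le_pow_left₀ (integral_nonneg fun _ => (Real.exp_pos _).le)
      (integral_exp_mul_le hY hYV ht₀ habs hV hB) n
  rw [hset]
  refine (measure_ge_le_exp_mul_mgf _ ht0 hinteg).trans ?_
  refine (mul_le_mul_of_nonneg_left hmgf (Real.exp_pos _).le).trans ?_
  rw [← Real.exp_add]
  exact Real.exp_le_exp.2 (by linarith)

/-- Bernstein's inequality for a variable with a sub-exponential envelope. -/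
theorem measureReal_lt_abs_empDev_le (hn : 0 < n) (hY : Measurable Y) (hYV : ∀ x, |Y x| ≤ V x)
    (ht₀ : 0 < t₀) (ht0 : 0 ≤ t) (ht : t ≤ t₀ / 2)
    (hV : Integrable (fun x => Real.exp (t₀ * V x)) P)
    (hB : ∫ x, Real.exp (t₀ * V x) ∂P ≤ B) (u : ℝ) :
    (Measure.pi fun _ : Fin n => P).real {x | u < |empDev P x Y|} ≤
      2 * Real.exp (n * (8 * B / t₀ ^ 2 * t ^ 2 - t * u)) := by
  have h1 := measureReal_le_empDev_le hn hY hYV ht₀ ht0 ht hV hB u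
  have h2 := measureReal_le_empDev_le hn hY.neg (V := V) (by simpa using hYV) ht₀ ht0 ht hV hB u
  have hsub : {x : Fin n → X | u < |empDev P x Y|} ⊆
      {x | u ≤ empDev P x Y} ∪ {x | u ≤ empDev P x (-Y)} := by
    intro x hx
    have hneg : empDev P x (-Y) = -empDev P x Y := empDev_neg x Y
    rcases lt_abs.1 (show u < |empDev P x Y| from hx) with h | h
    · exact Or.inl h.le
    · right; simp only [Set.mem_ofPred_eq, hneg]; exact h.le
  calc _ ≤ _ := measureReal_mono hsub
    _ ≤ _ := measureReal_union_le _ _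
    _ ≤ _ := by linarith

/-- A union bound over infinitely many pairs of features. A threshold proportional to the product of
the weights makes the tail at `(r, r')` at most `2 q^(r+1) q^(r'+1)` with `q = exp (-4L)`. The
double sum then factorizes into geometric series, each at most `2q` per element of `T`. -/
theorem measureReal_compl_goodSamples_le {J T : Type*} [Fintype J] [Fintype T]
    {φ : J → T × ℕ → X → ℝ} {V : J → X → ℝ} {L : ℝ} (hn : 0 < n)
    (hφ : ∀ j a, Measurable (φ j a)) (hφV : ∀ j a a' x, |φ j a x * φ j a' x| ≤ V j x)
    (ht₀ : 0 < t₀) (hV : ∀ j, Integrable (fun x => Real.exp (t₀ * V j x)) P)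
    (hB : ∀ j, ∫ x, Real.exp (t₀ * V j x) ∂P ≤ B) (hL : 1 ≤ L) (hLn : L ≤ n) :
    (Measure.pi fun _ : Fin n => P).real
        (goodSamples P n φ (2 * (2 * B + 8) / t₀ * Real.sqrt (L / n)))ᶜ ≤
      2 * Fintype.card J * (2 * Fintype.card T * Real.exp (-(4 * L))) ^ 2 := by
  set μ := Measure.pi fun _ : Fin n => P
  have hn' : (0 : ℝ) < n := Nat.cast_pos.2 hn
  set α := Real.sqrt (L / n) with hα
  have hα2 : n * α ^ 2 = L := by
    rw [hα, Real.sq_sqrt (by positivity)]; field_simp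
  have hα1 : α ≤ 1 := by
    rw [hα]; exact Real.sqrt_le_one.2 ((div_le_one hn').2 hLn)
  have hα0 : 0 ≤ α := Real.sqrt_nonneg _
  set q := Real.exp (-(4 * L)) with hq
  set bad : J × (T × ℕ) × (T × ℕ) → Set (Fin n → X) := fun i =>
    {x | 2 * (2 * B + 8) / t₀ * α * (((i.2.1.2 : ℝ) + 1) * ((i.2.2.2 : ℝ) + 1)) <
      |empDev P x fun y => φ i.1 i.2.1 y * φ i.1 i.2.2 y|} with hbad
  have hsub : (goodSamples P n φ (2 * (2 * B + 8) / t₀ * α))ᶜ ⊆ ⋃ i, bad i := by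
    intro x hx
    simp only [goodSamples, Set.mem_compl_iff, Set.mem_ofPred_eq, not_forall, not_le] at hx
    obtain ⟨j, a, a', h⟩ := hx
    exact Set.mem_iUnion.2 ⟨(j, a, a'), h⟩
  have hbad_le : ∀ i, μ (bad i) ≤
      2 * (ENNReal.ofReal q ^ (i.2.1.2 + 1) * ENNReal.ofReal q ^ (i.2.2.2 + 1)) := by
    rintro ⟨j, ⟨a, r⟩, ⟨a', r'⟩⟩
    have hB0 : 0 ≤ B := (integral_nonneg fun _ => (Real.exp_pos _).le).trans (hB j)
    -- The rate `t = α t₀ / 2` is admissible because `α ≤ 1`. With `n α² = L` the exponent becomes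
    -- `L (2B - (2B + 8) w w')`, where `w = r + 1` and `w' = r' + 1`. The `2B` in the threshold
    -- cancels the variance term, and the `8` leaves `-8 w w' ≤ -4 (w + w')`.
    have h := measureReal_lt_abs_empDev_le (P := P) hn ((hφ j (a, r)).mul (hφ j (a', r')))
      (fun x => hφV j (a, r) (a', r') x) ht₀ (t := α * (t₀ / 2)) (by positivity)
      (by nlinarith) (hV j) (hB j)
      (2 * (2 * B + 8) / t₀ * α * (((r : ℝ) + 1) * ((r' : ℝ) + 1)))
    have hexp : (n : ℝ) * (8 * B / t₀ ^ 2 * (α * (t₀ / 2)) ^ 2 - α * (t₀ / 2) *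
        (2 * (2 * B + 8) / t₀ * α * (((r : ℝ) + 1) * ((r' : ℝ) + 1)))) ≤
        ((r + 1 : ℕ) : ℝ) * (-(4 * L)) + ((r' + 1 : ℕ) : ℝ) * (-(4 * L)) := by
      have e : (n : ℝ) * (8 * B / t₀ ^ 2 * (α * (t₀ / 2)) ^ 2 - α * (t₀ / 2) *
          (2 * (2 * B + 8) / t₀ * α * (((r : ℝ) + 1) * ((r' : ℝ) + 1)))) =
          n * α ^ 2 * (2 * B - (2 * B + 8) * (((r : ℝ) + 1) * ((r' : ℝ) + 1))) := by
        field_simp; ring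
      rw [e, hα2]
      push_cast
      have hr : (0 : ℝ) ≤ r := Nat.cast_nonneg r
      have hr' : (0 : ℝ) ≤ r' := Nat.cast_nonneg r'
      have hrr : (0 : ℝ) ≤ r * r' := by positivity
      have : 2 * B - (2 * B + 8) * (((r : ℝ) + 1) * ((r' : ℝ) + 1)) ≤
          -(4 * ((r : ℝ) + 1)) - 4 * (r' + 1) := by
        have := mul_nonneg hB0 (add_nonneg (add_nonneg hrr hr) hr')
        nlinarith
      nlinarith [mul_le_mul_of_nonneg_left this (by linarith : 0 ≤ L)]
    have h' : μ.real (bad (j, (a, r), (a', r'))) ≤ 2 * (q ^ (r + 1) * q ^ (r' + 1)) := by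
      refine h.trans ?_
      rw [hq, ← Real.exp_nat_mul, ← Real.exp_nat_mul, ← Real.exp_add]
      gcongr
    rw [← ENNReal.ofReal_toReal (measure_ne_top μ (bad (j, (a, r), (a', r'))))]
    refine (ENNReal.ofReal_le_ofReal h').trans ?_
    rw [ENNReal.ofReal_mul (by norm_num), ENNReal.ofReal_mul (by positivity),
      ENNReal.ofReal_pow (Real.exp_pos _).le, ENNReal.ofReal_pow (Real.exp_pos _).le,
      ENNReal.ofReal_ofNat]
  set Q := ENNReal.ofReal q with hQ
  have hQ2 : Q ≤ 2⁻¹ := by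
    have h1 : q ≤ 2⁻¹ := by
      rw [hq, Real.exp_neg]
      refine inv_anti₀ (by norm_num) ?_
      have := Real.add_one_le_exp (4 * L)
      linarith
    calc Q ≤ ENNReal.ofReal 2⁻¹ := ENNReal.ofReal_le_ofReal h1
      _ = 2⁻¹ := by rw [ENNReal.ofReal_inv_of_pos (by norm_num)]; simp
  have hgeom : ∑' r : ℕ, Q ^ (r + 1) ≤ 2 * Q := by
    rw [ENNReal.tsum_geometric_add_one, mul_comm]
    gcongr
    rw [ENNReal.inv_le_iff_inv_le]
    rw [← ENNReal.one_sub_inv_two]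
    exact tsub_le_tsub_left hQ2 1
  have hfeat : ∑' a : T × ℕ, Q ^ (a.2 + 1) ≤ Fintype.card T * (2 * Q) := by
    rw [ENNReal.tsum_prod (f := fun _ r => Q ^ (r + 1)), tsum_fintype, Finset.sum_const,
      Finset.card_univ, nsmul_eq_mul]
    gcongr
  have hμ : μ (goodSamples P n φ (2 * (2 * B + 8) / t₀ * α))ᶜ ≤
      ENNReal.ofReal (2 * Fintype.card J * (2 * Fintype.card T * q) ^ 2) := by
    calc _ ≤ μ (⋃ i, bad i) := measure_mono hsub
      _ ≤ ∑' i, μ (bad i) := measure_iUnion_le _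
      _ ≤ ∑' i : J × (T × ℕ) × (T × ℕ), 2 * (Q ^ (i.2.1.2 + 1) * Q ^ (i.2.2.2 + 1)) :=
        ENNReal.tsum_le_tsum hbad_le
      _ = Fintype.card J * (2 * ((∑' a : T × ℕ, Q ^ (a.2 + 1)) * ∑' a : T × ℕ, Q ^ (a.2 + 1))) := by
        rw [ENNReal.tsum_prod (f := fun (_ : J) (i : (T × ℕ) × (T × ℕ)) =>
          2 * (Q ^ (i.1.2 + 1) * Q ^ (i.2.2 + 1))), tsum_fintype, Finset.sum_const,
          Finset.card_univ, nsmul_eq_mul, ENNReal.tsum_mul_left,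
          ENNReal.tsum_prod (f := fun a a' : T × ℕ => Q ^ (a.2 + 1) * Q ^ (a'.2 + 1))]
        simp_rw [ENNReal.tsum_mul_left, ENNReal.tsum_mul_right]
      _ ≤ Fintype.card J * (2 * ((Fintype.card T * (2 * Q)) * (Fintype.card T * (2 * Q)))) := by
        gcongr
      _ = _ := by
        have hq0 : 0 ≤ q := (Real.exp_pos _).le
        rw [ENNReal.ofReal_mul (by positivity), ENNReal.ofReal_mul (by positivity),
          ENNReal.ofReal_pow (by positivity), ENNReal.ofReal_mul (by positivity),
          ENNReal.ofReal_mul (by positivity)]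
        simp only [ENNReal.ofReal_ofNat, ENNReal.ofReal_natCast]
        ring
  exact ENNReal.toReal_le_of_le_ofReal (by positivity) hμ

end Concentration

/-! ### Deviations of absolutely convergent series of features -/

section FeatureSeries

variable {X ι : Type*} [MeasurableSpace X] {n : ℕ} {P : Measure X}

/-- `v` is a series in the features `φ` with weighted `ℓ₁` norm of the coefficients at most `B`. -/
def IsFeatureSeries (φ : ι → X → ℝ) (w : ι → ℝ) (B : ℝ) (v : X → ℝ) : Prop :=
  Measurable v ∧ ∃ γ : ι → ℝ, Summable (fun a => |γ a| * w a) ∧ ∑' a, |γ a| * w a ≤ B ∧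
    ∀ x, HasSum (fun a => γ a * φ a x) (v x)

variable {φ : ι → X → ℝ} {w : ι → ℝ} {B B' : ℝ} {u v : X → ℝ}

theorem IsFeatureSeries.add (hw : ∀ a, 0 ≤ w a) (hu : IsFeatureSeries φ w B u)
    (hv : IsFeatureSeries φ w B' v) : IsFeatureSeries φ w (B + B') fun x => u x + v x := by
  obtain ⟨hum, γ, hγ, hγB, hγu⟩ := hu
  obtain ⟨hvm, δ, hδ, hδB, hδv⟩ := hv
  have hle : ∀ a, |γ a + δ a| * w a ≤ |γ a| * w a + |δ a| * w a := fun a => by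
    rw [← add_mul]; exact mul_le_mul_of_nonneg_right (abs_add_le _ _) (hw a)
  have hsum : Summable fun a => |γ a + δ a| * w a :=
    (hγ.add hδ).of_nonneg_of_le (fun a => mul_nonneg (abs_nonneg _) (hw a)) hle
  refine ⟨hum.add hvm, fun a => γ a + δ a, hsum, ?_, fun x => ?_⟩
  · calc _ ≤ ∑' a, (|γ a| * w a + |δ a| * w a) := hsum.tsum_le_tsum hle (hγ.add hδ)
      _ = _ := hγ.tsum_add hδ
      _ ≤ _ := add_le_add hγB hδB
  · simpa only [add_mul] using (hγu x).add (hδv x)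

theorem IsFeatureSeries.neg (hv : IsFeatureSeries φ w B v) :
    IsFeatureSeries φ w B fun x => -v x := by
  obtain ⟨hvm, γ, hγ, hγB, hγv⟩ := hv
  refine ⟨hvm.neg, fun a => -γ a, by simpa using hγ, by simpa using hγB, fun x => ?_⟩
  simpa only [neg_mul] using (hγv x).neg

theorem IsFeatureSeries.zero : IsFeatureSeries φ w 0 fun _ => 0 :=
  ⟨measurable_const, 0, by simp, by simp, fun x => by simp⟩

theorem IsFeatureSeries.mono (hB : B ≤ B') (hv : IsFeatureSeries φ w B v) :
    IsFeatureSeries φ w B' v := by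
  obtain ⟨hvm, γ, hγ, hγB, hγv⟩ := hv
  exact ⟨hvm, γ, hγ, hγB.trans hB, hγv⟩

theorem IsFeatureSeries.sum (hw : ∀ a, 0 ≤ w a) {κ : Type*} (s : Finset κ) {v : κ → X → ℝ}
    (hv : ∀ k ∈ s, IsFeatureSeries φ w B (v k)) :
    IsFeatureSeries φ w (s.card * B) fun x => ∑ k ∈ s, v k x := by
  classical
  induction s using Finset.induction_on with
  | empty => simpa using IsFeatureSeries.zero
  | insert k s hk ih =>
    have h := (hv k (Finset.mem_insert_self _ _)).add hw
      (ih fun l hl => hv l (Finset.mem_insert_of_mem hl))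
    simp only [Finset.sum_insert hk, Finset.card_insert_of_notMem hk]
    exact h.mono (by push_cast; linarith)

theorem IsFeatureSeries.feature (a : ι) (hφ : Measurable (φ a)) (hw : w a = 1) :
    IsFeatureSeries φ w 1 (φ a) := by
  classical
  have h1 : HasSum (fun a' => |(Pi.single a (1 : ℝ) : ι → ℝ) a'| * w a') 1 := by
    have := hasSum_single (f := fun a' => |(Pi.single a (1 : ℝ) : ι → ℝ) a'| * w a') a
      (fun b hb => by simp [hb])
    simpa [hw] using this
  refine ⟨hφ, Pi.single a 1, h1.summable, h1.tsum_eq.le, fun x => ?_⟩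
  have := hasSum_single (f := fun a' => (Pi.single a (1 : ℝ) : ι → ℝ) a' * φ a' x) a
      (fun b hb => by simp [hb])
  simpa using this

/-- A product with a feature series inherits an envelope. -/
theorem IsFeatureSeries.abs_mul_le (hw : ∀ a, 1 ≤ w a) (hv : IsFeatureSeries φ w B v) {c V : ℝ}
    {x : X} (hV0 : 0 ≤ V) (hV : ∀ a, |c * φ a x| ≤ V) : |c * v x| ≤ B * V := by
  obtain ⟨-, γ, hγ, hγB, hγv⟩ := hv
  have hterm : ∀ a, ‖c * (γ a * φ a x)‖ ≤ |γ a| * w a * V := fun a => by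
    rw [Real.norm_eq_abs, show c * (γ a * φ a x) = γ a * (c * φ a x) by ring, abs_mul]
    refine mul_le_mul ?_ (hV a) (abs_nonneg _) (mul_nonneg (abs_nonneg _) (by linarith [hw a]))
    exact le_mul_of_one_le_right (abs_nonneg _) (hw a)
  rw [← ((hγv x).mul_left c).tsum_eq, ← Real.norm_eq_abs]
  calc _ ≤ ∑' a, |γ a| * w a * V := tsum_of_norm_bounded (hγ.mul_right V).hasSum hterm
    _ = (∑' a, |γ a| * w a) * V := tsum_mul_right
    _ ≤ _ := mul_le_mul_of_nonneg_right hγB hV0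

/-- The deviation is linear in its argument, and absolute convergence under the envelope lets it
pass through the series. What remains is Hölder's inequality between weighted `ℓ₁` coefficients and
deviations bounded by `A` times the weights. -/
theorem IsFeatureSeries.abs_empDev_mul_le [Countable ι] (hw : ∀ a, 1 ≤ w a)
    (hφ : ∀ a, Measurable (φ a)) (hv : IsFeatureSeries φ w B v) (hu : Measurable u)
    {V : X → ℝ} (hV : Integrable V P) (huV : ∀ a x, |u x * φ a x| ≤ V x) {x : Fin n → X} {A : ℝ}
    (hA0 : 0 ≤ A) (hA : ∀ a, |empDev P x fun y => u y * φ a y| ≤ A * w a) :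
    |empDev P x fun y => u y * v y| ≤ A * B := by
  obtain ⟨-, γ, hγ, hγB, hγv⟩ := hv
  have hinteg : ∀ a, Integrable (fun y => u y * φ a y) P := fun a =>
    hV.mono' (hu.mul (hφ a)).aestronglyMeasurable (Eventually.of_forall (huV a))
  have hI : HasSum (fun a => γ a * ∫ y, u y * φ a y ∂P) (∫ y, u y * v y ∂P) := by
    have h := hasSum_integral_of_summable_integral_norm
      (F := fun a y => γ a * (u y * φ a y)) (μ := P) (fun a => (hinteg a).const_mul _) ?_
    · simp only [integral_const_mul] at h
      have e : ∀ y, ∑' a, γ a * (u y * φ a y) = u y * v y := fun y => by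
        rw [← ((hγv y).mul_left (u y)).tsum_eq]
        exact tsum_congr fun a => by ring
      simpa only [e] using h
    · refine (hγ.mul_right (∫ y, V y ∂P)).of_nonneg_of_le
        (fun a => integral_nonneg fun _ => norm_nonneg _) fun a => ?_
      simp only [norm_mul (γ a), integral_const_mul]
      have hVn : ∫ y, ‖u y * φ a y‖ ∂P ≤ ∫ y, V y ∂P := integral_mono (hinteg a).norm hV (huV a)
      refine mul_le_mul ?_ hVn (integral_nonneg fun _ => norm_nonneg _)
        (mul_nonneg (abs_nonneg _) (by linarith [hw a]))
      exact le_mul_of_one_le_right (abs_nonneg _) (hw a)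
  have hE : HasSum (fun a => γ a * ((n : ℝ)⁻¹ * ∑ i, u (x i) * φ a (x i)))
      ((n : ℝ)⁻¹ * ∑ i, u (x i) * v (x i)) := by
    have h := (hasSum_sum (s := Finset.univ) fun i _ => (hγv (x i)).mul_left (u (x i))).mul_left
      (n : ℝ)⁻¹
    have e : ∀ a, (n : ℝ)⁻¹ * ∑ i, u (x i) * (γ a * φ a (x i)) =
        γ a * ((n : ℝ)⁻¹ * ∑ i, u (x i) * φ a (x i)) := fun a => by
      rw [Finset.mul_sum, Finset.mul_sum, Finset.mul_sum]
      exact Finset.sum_congr rfl fun i _ => by ring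
    simpa only [e] using h
  have hD : HasSum (fun a => γ a * empDev P x fun y => u y * φ a y)
      (empDev P x fun y => u y * v y) := by
    simpa only [empDev, mul_sub] using hE.sub hI
  rw [← hD.tsum_eq, ← Real.norm_eq_abs]
  calc _ ≤ ∑' a, A * (|γ a| * w a) := by
        refine tsum_of_norm_bounded (hγ.mul_left A).hasSum fun a => ?_
        rw [norm_mul, Real.norm_eq_abs, Real.norm_eq_abs]
        nlinarith [mul_le_mul_of_nonneg_left (hA a) (abs_nonneg (γ a))]
    _ = A * ∑' a, |γ a| * w a := tsum_mul_left
    _ ≤ _ := mul_le_mul_of_nonneg_left hγB hA0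

/-- On good samples the empirical second moment of a feature series is close to the true one, and
so is its empirical product with every feature. -/
theorem IsFeatureSeries.abs_empDev_sq_le [Countable ι] (hw : ∀ a, 1 ≤ w a)
    (hφ : ∀ a, Measurable (φ a)) (hv : IsFeatureSeries φ w B v)
    {V : X → ℝ} (hV : Integrable V P) (hφV : ∀ a a' x, |φ a x * φ a' x| ≤ V x) {x : Fin n → X}
    {A : ℝ} (hA0 : 0 ≤ A) (hB0 : 0 ≤ B)
    (hA : ∀ a a', |empDev P x fun y => φ a y * φ a' y| ≤ A * (w a * w a')) :
    (∀ a, |empDev P x fun y => φ a y * v y| ≤ A * w a * B) ∧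
      |empDev P x fun y => v y * v y| ≤ A * B * B := by
  -- Bilinearity is used one slot at a time: a feature against the series here, then the series
  -- against itself.
  have h1 : ∀ a, |empDev P x fun y => φ a y * v y| ≤ A * w a * B := fun a =>
    hv.abs_empDev_mul_le hw hφ (hφ a) hV (hφV a) (mul_nonneg hA0 (by linarith [hw a]))
      fun a' => by rw [mul_assoc]; exact hA a a'
  refine ⟨h1, hv.abs_empDev_mul_le hw hφ hv.1 (hV.const_mul B) (fun a y => ?_)
    (mul_nonneg hA0 hB0) fun a => ?_⟩
  · rw [mul_comm]; exact hv.abs_mul_le hw ((abs_nonneg _).trans (hφV a a y)) fun a' => hφV a a' y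
  · simp only [mul_comm (v _)]
    linarith [h1 a]

end FeatureSeries

/-! ### The noise variables of the model -/

/-- Multiplying the density by `exp (y² / 4v)` leaves an unnormalized Gaussian of variance `2v`, so
the value is the ratio of the two normalizing constants. -/
theorem integral_exp_sq_gaussianReal {v : NNReal} (hv : v ≠ 0) :
    ∫ y, Real.exp (y ^ 2 / (4 * v)) ∂gaussianReal 0 v = Real.sqrt 2 := by
  have hv' : (0 : ℝ) < v := NNReal.coe_pos.2 (pos_iff_ne_zero.2 hv)
  rw [integral_gaussianReal_eq_integral_smul hv]
  have e : ∀ y : ℝ, gaussianPDFReal 0 v y • Real.exp (y ^ 2 / (4 * v)) =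
      (Real.sqrt (2 * Real.pi * v))⁻¹ * Real.exp (-(1 / (4 * (v : ℝ))) * y ^ 2) := fun y => by
    rw [gaussianPDFReal, smul_eq_mul, mul_assoc, ← Real.exp_add]
    congr 2
    field_simp
    ring
  simp_rw [e]
  rw [integral_const_mul, integral_gaussian, ← Real.sqrt_inv, ← Real.sqrt_mul (by positivity)]
  congr 1
  have := Real.pi_pos
  field_simp
  ring

theorem integrable_exp_sq_gaussianReal {v : NNReal} (hv : v ≠ 0) :
    Integrable (fun y => Real.exp (y ^ 2 / (4 * v))) (gaussianReal 0 v) := by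
  -- The Bochner integral of a non-integrable function is `0` by convention, so the positive value
  -- just computed forces integrability.
  by_contra h
  have h1 := integral_exp_sq_gaussianReal hv
  rw [integral_undef h] at h1
  have : (0 : ℝ) < Real.sqrt 2 := by positivity
  linarith

/-- On a finite vertex set acyclicity is well-foundedness, which permits induction from parents to
children. -/
theorem IsDAG.wellFounded {p : ℕ} {E : Finset (Fin p × Fin p)} (hE : IsDAG E) :
    WellFounded fun k j => (k, j) ∈ E := by
  have : IsTrans (Fin p) (Relation.TransGen fun k j => (k, j) ∈ E) := inferInstance
  have : Std.Irrefl (Relation.TransGen fun k j => (k, j) ∈ E) := ⟨hE⟩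
  exact Subrelation.wf (fun h => Relation.TransGen.single h)
    (Finite.wellFounded_of_trans_of_irrefl (Relation.TransGen fun k j => (k, j) ∈ E))

theorem IsDAG.mono {p : ℕ} {E E' : Finset (Fin p × Fin p)} (hE : IsDAG E) (h : E' ⊆ E) :
    IsDAG E' := fun v hv => hE v (Relation.TransGen.mono (fun _ _ hab => h hab) _ _ hv)

theorem ThreeTimesDifferentiable.continuous {h : ℝ → ℝ} (hh : ThreeTimesDifferentiable h) :
    Continuous h := by
  have := hh 0 (by norm_num)
  rw [iteratedDeriv_zero] at this
  exact this.continuous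

theorem mem_parents {p : ℕ} {E : Finset (Fin p × Fin p)} {k j : Fin p} :
    k ∈ parents E j ↔ (k, j) ∈ E := by
  simp [parents]

namespace CausalAdditiveModel

variable {p : ℕ} (m : CausalAdditiveModel p)

/-- The noise variable of node `j`. -/
noncomputable def noise (j : Fin p) (x : Fin p → ℝ) : ℝ :=
  x j - ∑ k ∈ parents m.E j, m.f k j (x k)

variable {m}

theorem Identifiable.continuous_f (hid : m.Identifiable) (k j : Fin p) :
    Continuous (m.f k j) := by
  by_cases h : m.f k j = 0
  · rw [h]; exact continuous_const
  · exact (hid k j h).2.continuous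

theorem Identifiable.measurable_noise (hid : m.Identifiable) (j : Fin p) :
    Measurable (m.noise j) := by
  have := fun k => (hid.continuous_f k j).measurable
  unfold noise
  fun_prop

variable (m) in
theorem map_noise (j : Fin p) :
    m.P.map (m.noise j) = gaussianReal 0 (Real.toNNReal (m.σ j ^ 2)) := m.noise_law j

theorem Identifiable.integral_noise_comp (hid : m.Identifiable) (j : Fin p) {h : ℝ → ℝ}
    (hh : Measurable h) : ∫ x, h (m.noise j x) ∂m.P =
      ∫ y, h y ∂gaussianReal 0 (Real.toNNReal (m.σ j ^ 2)) := by
  rw [← m.map_noise j, integral_map (hid.measurable_noise j).aemeasurable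
    hh.aestronglyMeasurable]

theorem Identifiable.integrable_noise_comp (hid : m.Identifiable) (j : Fin p) {h : ℝ → ℝ}
    (hh : Measurable h) : Integrable (fun x => h (m.noise j x)) m.P ↔
      Integrable h (gaussianReal 0 (Real.toNNReal (m.σ j ^ 2))) := by
  rw [← m.map_noise j, integrable_map_measure hh.aestronglyMeasurable
    (hid.measurable_noise j).aemeasurable]
  rfl

variable (m) in
theorem toNNReal_sq_ne_zero (j : Fin p) : Real.toNNReal (m.σ j ^ 2) ≠ 0 := by
  have := m.σ_pos j
  rw [Ne, Real.toNNReal_eq_zero, not_le]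
  positivity

theorem Identifiable.integral_noise (hid : m.Identifiable) (j : Fin p) :
    ∫ x, m.noise j x ∂m.P = 0 := by
  rw [hid.integral_noise_comp j measurable_id']
  exact integral_id_gaussianReal

theorem Identifiable.integral_noise_sq (hid : m.Identifiable) (j : Fin p) :
    ∫ x, m.noise j x ^ 2 ∂m.P = m.σ j ^ 2 := by
  rw [hid.integral_noise_comp j (h := fun y => y ^ 2) (by fun_prop)]
  have h := variance_fun_id_gaussianReal (μ := 0) (v := Real.toNNReal (m.σ j ^ 2))
  rw [variance_of_integral_eq_zero (by fun_prop) integral_id_gaussianReal,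
    Real.coe_toNNReal _ (sq_nonneg _)] at h
  exact h

theorem Identifiable.memLp_noise (hid : m.Identifiable) (j : Fin p) :
    MemLp (m.noise j) 2 m.P := by
  have h := memLp_id_gaussianReal (μ := 0) (v := Real.toNNReal (m.σ j ^ 2)) 2
  rw [← m.map_noise j] at h
  exact h.comp_of_map (hid.measurable_noise j).aemeasurable

theorem Identifiable.integrable_noise_sq (hid : m.Identifiable) (j : Fin p) :
    Integrable (fun x => m.noise j x ^ 2) m.P := (hid.memLp_noise j).integrable_sq

theorem Identifiable.integrable_noise (hid : m.Identifiable) (j : Fin p) :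
    Integrable (m.noise j) m.P :=
  have := m.isProb
  (hid.memLp_noise j).integrable (by norm_num)

/-- The envelope `(2 + |ε_j|)²` is sub-exponential, uniformly in the variance. -/
theorem Identifiable.exp_envelope (hid : m.Identifiable) {σbar : ℝ} (j : Fin p)
    (hσ : m.σ j ^ 2 ≤ σbar ^ 2) :
    Integrable (fun x => Real.exp (1 / (8 * σbar ^ 2) * (2 + |m.noise j x|) ^ 2)) m.P ∧
      ∫ x, Real.exp (1 / (8 * σbar ^ 2) * (2 + |m.noise j x|) ^ 2) ∂m.P ≤
        Real.exp (1 / σbar ^ 2) * Real.sqrt 2 := by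
  have hpos : 0 < m.σ j ^ 2 := by have := m.σ_pos j; positivity
  have hbar : 0 < σbar ^ 2 := hpos.trans_le hσ
  set v := Real.toNNReal (m.σ j ^ 2) with hv
  have hvc : (v : ℝ) = m.σ j ^ 2 := Real.coe_toNNReal _ hpos.le
  have hpt : ∀ x, Real.exp (1 / (8 * σbar ^ 2) * (2 + |m.noise j x|) ^ 2) ≤
      Real.exp (1 / σbar ^ 2) * Real.exp (m.noise j x ^ 2 / (4 * v)) := fun x => by
    rw [← Real.exp_add, Real.exp_le_exp, hvc]
    -- With rate `1 / (8 σbar²)` the constant `8` contributes the factor `exp (1 / σbar²)`, and `2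
    -- ε²` contributes `ε² / (4 σbar²)`, below the exponent whose Gaussian expectation is `√2`.
    have h1 : (2 + |m.noise j x|) ^ 2 ≤ 8 + 2 * m.noise j x ^ 2 := by
      nlinarith [sq_nonneg (2 - |m.noise j x|), sq_abs (m.noise j x)]
    have h2 : m.noise j x ^ 2 / (4 * σbar ^ 2) ≤ m.noise j x ^ 2 / (4 * m.σ j ^ 2) := by
      gcongr
    calc _ ≤ 1 / (8 * σbar ^ 2) * (8 + 2 * m.noise j x ^ 2) :=
          mul_le_mul_of_nonneg_left h1 (by positivity)
      _ = 1 / σbar ^ 2 + m.noise j x ^ 2 / (4 * σbar ^ 2) := by field_simp; ring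
      _ ≤ _ := by linarith
  have hinteg : Integrable (fun x => Real.exp (1 / σbar ^ 2) *
      Real.exp (m.noise j x ^ 2 / (4 * v))) m.P :=
    ((hid.integrable_noise_comp j (h := fun y => Real.exp (y ^ 2 / (4 * v))) (by fun_prop)).2
      (integrable_exp_sq_gaussianReal (m.toNNReal_sq_ne_zero j))).const_mul _
  have hmeas := hid.measurable_noise j
  have hinteg' : Integrable
      (fun x => Real.exp (1 / (8 * σbar ^ 2) * (2 + |m.noise j x|) ^ 2)) m.P :=
    hinteg.mono' (by fun_prop) (Eventually.of_forall fun x => by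
      rw [Real.norm_eq_abs, Real.abs_exp]; exact hpt x)
  refine ⟨hinteg', (integral_mono hinteg' hinteg hpt).trans_eq ?_⟩
  rw [integral_const_mul,
    hid.integral_noise_comp j (h := fun y => Real.exp (y ^ 2 / (4 * v))) (by fun_prop),
    integral_exp_sq_gaussianReal (m.toNNReal_sq_ne_zero j)]

/-- A variable that is not a descendant of `j` is a function of the noise at the other nodes. -/
theorem Identifiable.measurable_of_not_descendant (hid : m.Identifiable) (j k : Fin p)
    (hk : ¬ Relation.ReflTransGen (fun k j => (k, j) ∈ m.E) j k) :
    Measurable[⨆ l ∈ ({j}ᶜ : Set (Fin p)), MeasurableSpace.comap (m.noise l) inferInstance]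
      fun x : Fin p → ℝ => x k := by
  induction k using m.isDAG.wellFounded.induction with
  | _ k ih =>
    have hne : k ≠ j := by rintro rfl; exact hk Relation.ReflTransGen.refl
    -- The structural equation expresses `X_k` through its own noise and its parents. Parents of a
    -- non-descendant of `j` are again non-descendants of `j`, so the induction hypothesis applies.
    have e : (fun x : Fin p → ℝ => x k) =
        fun x => m.noise k x + ∑ l ∈ parents m.E k, m.f l k (x l) := by
      funext x; simp [noise]
    rw [e]
    have h1 : Measurable[⨆ l ∈ ({j}ᶜ : Set (Fin p)),
        MeasurableSpace.comap (m.noise l) inferInstance] (m.noise k) :=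
      (comap_measurable (m.noise k)).mono (le_iSup₂_of_le (f := fun l (_ : l ∈ ({j}ᶜ : Set (Fin p)))
        => MeasurableSpace.comap (m.noise l) inferInstance) k (by simpa using hne) le_rfl) le_rfl
    refine Measurable.add h1 (Finset.measurable_sum _ fun l hl => ?_)
    have hlk := mem_parents.1 hl
    exact (hid.continuous_f l k).measurable.comp (ih l hlk fun h => hk (h.tail hlk))

/-- The noise at `j` is uncorrelated with functions of the parents of `j`. -/
theorem Identifiable.integral_noise_mul_parents (hid : m.Identifiable) (j : Fin p)
    {h : Fin p → ℝ → ℝ} (hh : ∀ k ∈ parents m.E j, Measurable (h k)) :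
    ∫ x, m.noise j x * ∑ k ∈ parents m.E j, h k (x k) ∂m.P = 0 := by
  have hind : Indep (⨆ l ∈ ({j} : Set (Fin p)), MeasurableSpace.comap (m.noise l) inferInstance)
      (⨆ l ∈ ({j}ᶜ : Set (Fin p)), MeasurableSpace.comap (m.noise l) inferInstance) m.P :=
    indep_iSup_of_disjoint (fun l => (hid.measurable_noise l).comap_le) m.noise_indep
      disjoint_compl_right
  have hQ : Measurable[⨆ l ∈ ({j}ᶜ : Set (Fin p)),
      MeasurableSpace.comap (m.noise l) inferInstance]
      fun x : Fin p → ℝ => ∑ k ∈ parents m.E j, h k (x k) := by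
    refine Finset.measurable_sum _ fun k hk => (hh k hk).comp
      (hid.measurable_of_not_descendant j k fun hjk => ?_)
    exact m.isDAG k (Relation.TransGen.head' (mem_parents.1 hk) hjk)
  have hfun : IndepFun (m.noise j) (fun x : Fin p → ℝ => ∑ k ∈ parents m.E j, h k (x k)) m.P := by
    refine indep_of_indep_of_le_right (indep_of_indep_of_le_left hind ?_) hQ.comap_le
    simp
  have hQm : Measurable fun x : Fin p → ℝ => ∑ k ∈ parents m.E j, h k (x k) :=
    Finset.measurable_sum _ fun k hk => (hh k hk).comp (measurable_pi_apply k)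
  rw [hfun.integral_fun_mul_eq_mul_integral (hid.measurable_noise j).aestronglyMeasurable
    hQm.aestronglyMeasurable, hid.integral_noise, zero_mul]

end CausalAdditiveModel

/-! ### Series in the basis functions -/

section Series

variable {p : ℕ} {b : ℕ → Fin p → Fin p → ℝ → ℝ} {P : Measure (Fin p → ℝ)} {C η : ℝ}
  {k j : Fin p} {β : ℕ → ℝ}

theorem IsBoundedBasis.continuous (hb : IsBoundedBasis b P) (hkj : k ≠ j) (r : ℕ) :
    Continuous (b r k j) := (hb.smooth r k j hkj).continuous

theorem one_le_weight_rpow (hη : 1 < η) (r : ℕ) : 1 ≤ ((r : ℝ) + 1) ^ η :=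
  Real.one_le_rpow (by linarith [(Nat.cast_nonneg r : (0 : ℝ) ≤ r)]) (by linarith)

theorem weight_le_rpow (hη : 1 < η) (r : ℕ) : (r : ℝ) + 1 ≤ ((r : ℝ) + 1) ^ η :=
  Real.self_le_rpow_of_one_le (by linarith [(Nat.cast_nonneg r : (0 : ℝ) ≤ r)]) hη.le

theorem InEllipsoid.nonneg (hβ : InEllipsoid C η β) : 0 ≤ C :=
  (tsum_nonneg fun r => by positivity).trans hβ.2

theorem InEllipsoid.summable_abs (hη : 1 < η) (hβ : InEllipsoid C η β) :
    Summable fun r => |β r| :=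
  hβ.1.of_nonneg_of_le (fun _ => abs_nonneg _) fun r =>
    le_mul_of_one_le_right (abs_nonneg _) (one_le_weight_rpow hη r)

/-- The exponent `η > 1` is traded for the linear weight that the union bound over features
requires. -/
theorem InEllipsoid.weighted (hη : 1 < η) (hβ : InEllipsoid C η β) :
    Summable (fun r : ℕ => |β r| * ((r : ℝ) + 1)) ∧ ∑' r : ℕ, |β r| * ((r : ℝ) + 1) ≤ C := by
  have hle : ∀ r : ℕ, |β r| * ((r : ℝ) + 1) ≤ |β r| * ((r : ℝ) + 1) ^ η := fun r =>
    mul_le_mul_of_nonneg_left (weight_le_rpow hη r) (abs_nonneg _)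
  have hs : Summable (fun r : ℕ => |β r| * ((r : ℝ) + 1)) :=
    hβ.1.of_nonneg_of_le (fun _ => by positivity) hle
  exact ⟨hs, (hs.tsum_le_tsum hle hβ.1).trans hβ.2⟩

theorem InEllipsoid.zero (hC : 0 ≤ C) : InEllipsoid C η 0 := by
  simp [InEllipsoid, summable_zero, hC]

theorem IsBoundedBasis.norm_term_le (hb : IsBoundedBasis b P) (hkj : k ≠ j) (r : ℕ) (t : ℝ) :
    ‖β r * b r k j t‖ ≤ |β r| := by
  rw [norm_mul, Real.norm_eq_abs, Real.norm_eq_abs]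
  exact mul_le_of_le_one_right (abs_nonneg _) (hb.bounded r k j hkj t)

theorem IsBoundedBasis.continuous_series (hb : IsBoundedBasis b P) (hkj : k ≠ j)
    (hβ : Summable fun r => |β r|) : Continuous fun t => ∑' r, β r * b r k j t :=
  continuous_tsum (fun r => continuous_const.mul (hb.continuous hkj r)) hβ
    fun r t => hb.norm_term_le hkj r t

theorem IsBoundedBasis.continuous_seriesFun (hb : IsBoundedBasis b P) (hkj : k ≠ j)
    (hβ : Summable fun r => |β r|) : Continuous (seriesFun b P β k j) :=
  continuous_const.add (hb.continuous_series hkj hβ)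

theorem seriesFun_zero : seriesFun b P 0 k j = 0 := by
  funext t; simp [seriesFun]

theorem IsBoundedBasis.abs_series_le (hb : IsBoundedBasis b P) (hkj : k ≠ j)
    (hβ : Summable fun r => |β r|) (t : ℝ) : |∑' r, β r * b r k j t| ≤ ∑' r, |β r| :=
  tsum_of_norm_bounded hβ.hasSum fun r => hb.norm_term_le hkj r t

/-- Extension of a finite coefficient array by zero. -/
def extendCoef {R : ℕ} (β : Fin R → Fin p → Fin p → ℝ) (k j : Fin p) (r : ℕ) : ℝ :=
  if h : r < R then β ⟨r, h⟩ k j else 0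

theorem tsum_extendCoef_mul {R : ℕ} (β : Fin R → Fin p → Fin p → ℝ) (k j : Fin p) (c : ℕ → ℝ) :
    ∑' r, extendCoef β k j r * c r = ∑ r : Fin R, β r k j * c r := by
  rw [tsum_eq_sum (s := Finset.range R) fun r hr => by
      simp [extendCoef, Finset.mem_range.not.1 hr], ← Fin.sum_univ_eq_sum_range]
  exact Finset.sum_congr rfl fun r _ => by simp [extendCoef]

theorem summable_extendCoef_mul {R : ℕ} (β : Fin R → Fin p → Fin p → ℝ) (k j : Fin p)
    (c : ℕ → ℝ) : Summable fun r => |extendCoef β k j r| * c r :=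
  summable_of_ne_finset_zero (s := Finset.range R) fun r hr => by
    simp [extendCoef, Finset.mem_range.not.1 hr]

theorem truncFun_eq_seriesFun {R : ℕ} (β : Fin R → Fin p → Fin p → ℝ) (k j : Fin p) :
    truncFun b P β k j = seriesFun b P (extendCoef β k j) k j := by
  funext t
  simp only [truncFun, intercept, seriesFun, tsum_extendCoef_mul]

theorem CoefBound.inEllipsoid {R : ℕ} {β : Fin R → Fin p → Fin p → ℝ} (hβ : CoefBound C η β)
    (hkj : k ≠ j) : InEllipsoid C η (extendCoef β k j) := by
  refine ⟨summable_extendCoef_mul β k j _, ?_⟩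
  have h := tsum_extendCoef_mul (fun r k j => |β r k j|) k j fun r : ℕ => ((r : ℝ) + 1) ^ η
  have e : ∀ r, extendCoef (fun r k j => |β r k j|) k j r = |extendCoef β k j r| := fun r => by
    unfold extendCoef; split_ifs <;> simp
  simp only [e] at h
  rw [h]
  exact hβ k j hkj

/-- A truncated model is a member of the full class, so bounds for the class apply to it uniformly
in the number of basis functions. -/
theorem truncFun_mem_classF {R : ℕ} {β : Fin R → Fin p → Fin p → ℝ} (hβ : CoefBound C η β)
    (hkj : k ≠ j) : truncFun b P β k j ∈ classF b P C η k j :=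
  ⟨_, hβ.inEllipsoid hkj, truncFun_eq_seriesFun β k j⟩

theorem extendCoef_truncation (β : ℕ → Fin p → Fin p → ℝ) (R r : ℕ) (k j : Fin p) :
    extendCoef (fun (r : Fin R) k j => β r k j) k j r = if r < R then β r k j else 0 := by
  unfold extendCoef; split_ifs <;> rfl

variable [IsProbabilityMeasure P]

theorem IsBoundedBasis.integrable_basis (hb : IsBoundedBasis b P) (hkj : k ≠ j) (r : ℕ) :
    Integrable (fun x => b r k j (x k)) P := by
  have := (hb.continuous hkj r).measurable
  exact (integrable_const (1 : ℝ)).mono' (this.comp (measurable_pi_apply k)).aestronglyMeasurable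
    (Eventually.of_forall fun x => hb.bounded r k j hkj (x k))

/-- The centred basis functions. -/
noncomputable def centredBasis (b : ℕ → Fin p → Fin p → ℝ → ℝ) (P : Measure (Fin p → ℝ)) (r : ℕ) (k j : Fin p) (t : ℝ) : ℝ :=
  b r k j t - ∫ x, b r k j (x k) ∂P

theorem IsBoundedBasis.abs_centredBasis_le (hb : IsBoundedBasis b P) (hkj : k ≠ j) (r : ℕ)
    (t : ℝ) : |centredBasis b P r k j t| ≤ 2 := by
  have h1 : |∫ x, b r k j (x k) ∂P| ≤ 1 := by
    refine (abs_integral_le_integral_abs).trans ?_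
    refine (integral_mono (hb.integrable_basis hkj r).abs (integrable_const (1 : ℝ))
      fun x => hb.bounded r k j hkj (x k)).trans ?_
    simp
  exact (abs_sub _ _).trans (by linarith [hb.bounded r k j hkj t])

/-- The mean-zero intercept is distributed over the terms of the series, which makes the function a
series in centred basis functions with unchanged coefficients. -/
theorem IsBoundedBasis.hasSum_seriesFun (hb : IsBoundedBasis b P) (hkj : k ≠ j)
    (hβ : Summable fun r => |β r|) (t : ℝ) :
    HasSum (fun r => β r * centredBasis b P r k j t) (seriesFun b P β k j t) := by
  have h1 : HasSum (fun r => β r * b r k j t) (∑' r, β r * b r k j t) :=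
    (hβ.of_norm_bounded fun r => hb.norm_term_le hkj r t).hasSum
  have h2 := hasSum_integral_of_summable_integral_norm (μ := P)
    (F := fun r (x : Fin p → ℝ) => β r * b r k j (x k))
    (fun r => (hb.integrable_basis hkj r).const_mul _)
    (hβ.of_nonneg_of_le (fun r => integral_nonneg fun _ => norm_nonneg _) fun r => by
      refine (integral_mono ((hb.integrable_basis hkj r).const_mul _).norm
        (integrable_const |β r|) fun x => hb.norm_term_le hkj r (x k)).trans ?_
      simp)
  simp only [integral_const_mul] at h2
  have h3 := h1.sub h2
  simp only [← mul_sub] at h3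
  rw [seriesFun, neg_add_eq_sub]
  exact h3

theorem IsBoundedBasis.integral_seriesFun (hb : IsBoundedBasis b P) (hkj : k ≠ j)
    (hβ : Summable fun r => |β r|) :
    Integrable (fun x => seriesFun b P β k j (x k)) P ∧
      ∫ x, seriesFun b P β k j (x k) ∂P = 0 := by
  have hm := (hb.continuous_series hkj hβ).measurable
  have hi : Integrable (fun x : Fin p → ℝ => ∑' r, β r * b r k j (x k)) P :=
    (integrable_const (∑' r, |β r|)).mono'
      (hm.comp (measurable_pi_apply k)).aestronglyMeasurable
      (Eventually.of_forall fun x => hb.abs_series_le hkj hβ (x k))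
  refine ⟨(integrable_const _).add hi, ?_⟩
  simp only [seriesFun]
  rw [integral_add (integrable_const _) hi]
  simp

/-- The uniform error of truncating a series. -/
theorem IsBoundedBasis.abs_seriesFun_sub_truncFun_le (hb : IsBoundedBasis b P) (hη : 1 < η)
    (hkj : k ≠ j) {β : ℕ → Fin p → Fin p → ℝ} (hβ : InEllipsoid C η fun r => β r k j) {R : ℕ}
    (hR : 0 < R) (t : ℝ) :
    |seriesFun b P (fun r => β r k j) k j t -
      truncFun b P (fun (r : Fin R) k j => β r k j) k j t| ≤ 2 * C * (R : ℝ) ^ (-η) := by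
  have hR' : (0 : ℝ) < R := Nat.cast_pos.2 hR
  rw [truncFun_eq_seriesFun]
  have h1 := hb.hasSum_seriesFun hkj (hβ.summable_abs hη) t
  have h2 := hb.hasSum_seriesFun hkj
    (by simpa using summable_extendCoef_mul (fun (r : Fin R) k j => β r k j) k j fun _ => 1) t
  have h3 := h1.sub h2
  rw [← h3.tsum_eq, ← Real.norm_eq_abs]
  refine (tsum_of_norm_bounded (hβ.1.mul_left (2 * (R : ℝ) ^ (-η))).hasSum fun r => ?_).trans ?_
  · rw [extendCoef_truncation, ← sub_mul, norm_mul, Real.norm_eq_abs, Real.norm_eq_abs]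
    have hc := hb.abs_centredBasis_le hkj r t
    split_ifs with hr
    · simp only [sub_self, abs_zero, zero_mul]; positivity
    · have h4 : 1 ≤ (R : ℝ) ^ (-η) * ((r : ℝ) + 1) ^ η := by
        rw [Real.rpow_neg hR'.le, inv_mul_eq_div, one_le_div (by positivity)]
        refine Real.rpow_le_rpow hR'.le ?_ (by linarith)
        have : (R : ℝ) ≤ r := Nat.cast_le.2 (not_lt.1 hr)
        linarith
      rw [sub_zero]
      calc _ ≤ |β r k j| * 2 := mul_le_mul_of_nonneg_left hc (abs_nonneg _)
        _ ≤ |β r k j| * 2 * ((R : ℝ) ^ (-η) * ((r : ℝ) + 1) ^ η) :=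
          le_mul_of_one_le_right (by positivity) h4
        _ = _ := by ring
  · rw [tsum_mul_left]
    calc _ ≤ 2 * (R : ℝ) ^ (-η) * C := mul_le_mul_of_nonneg_left hβ.2 (by positivity)
      _ = _ := by ring

end Series

/-! ### Features of a node and their deviations -/

section Features

variable {p : ℕ} {m : CausalAdditiveModel p} {b : ℕ → Fin p → Fin p → ℝ → ℝ}

variable (m b) in
/-- The features of node `j`: the constant, the noise, and the centred basis functions of the other
variables. -/
noncomputable def feature (j : Fin p) : Option (Option (Fin p)) × ℕ → (Fin p → ℝ) → ℝ
  -- The constant and the noise are repeated for every second index, so that the index type is a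
  -- product; only their copies of weight one, at index `0`, serve in expansions. The slot `k = j`
  -- is set to zero because the basis is controlled only off the diagonal.
  | (none, _), _ => 1
  | (some none, _), x => m.noise j x
  | (some (some k), r), x => if k = j then 0 else centredBasis b m.P r k j (x k)

/-- The weight of a feature. -/
def featureWeight {T : Type*} (a : T × ℕ) : ℝ := (a.2 : ℝ) + 1

theorem one_le_featureWeight {T : Type*} (a : T × ℕ) : 1 ≤ featureWeight a := by
  have : (0 : ℝ) ≤ a.2 := Nat.cast_nonneg _
  simp only [featureWeight]; linarith

theorem featureWeight_nonneg {T : Type*} (a : T × ℕ) : 0 ≤ featureWeight a :=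
  zero_le_one.trans (one_le_featureWeight a)

theorem measurable_feature (hid : m.Identifiable) (hb : IsBoundedBasis b m.P) (j : Fin p) :
    ∀ a, Measurable (feature m b j a)
  | (none, _) => measurable_const
  | (some none, _) => hid.measurable_noise j
  | (some (some k), r) => by
    change Measurable fun x : Fin p → ℝ => if k = j then 0 else centredBasis b m.P r k j (x k)
    split_ifs with hkj
    · exact measurable_const
    · exact ((hb.continuous hkj r).measurable.comp (measurable_pi_apply k)).sub_const _

theorem abs_feature_le (hb : IsBoundedBasis b m.P) (j : Fin p) (x : Fin p → ℝ) :
    ∀ a, |feature m b j a x| ≤ 2 + |m.noise j x|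
  | (none, _) => by simp only [feature, abs_one]; linarith [abs_nonneg (m.noise j x)]
  | (some none, _) => by simp only [feature]; linarith
  | (some (some k), r) => by
    have := m.isProb
    by_cases hkj : k = j
    · simp only [feature, hkj, if_true, abs_zero]; positivity
    · simp only [feature, hkj, if_false]
      linarith [hb.abs_centredBasis_le hkj r (x k), abs_nonneg (m.noise j x)]

theorem abs_feature_mul_le (hb : IsBoundedBasis b m.P) (j : Fin p)
    (a a' : Option (Option (Fin p)) × ℕ) (x : Fin p → ℝ) :
    |feature m b j a x * feature m b j a' x| ≤ (2 + |m.noise j x|) ^ 2 := by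
  rw [abs_mul, sq]
  exact mul_le_mul (abs_feature_le hb j x a) (abs_feature_le hb j x a') (abs_nonneg _)
    (by positivity)

theorem integrable_envelope (hid : m.Identifiable) (j : Fin p) :
    Integrable (fun x => (2 + |m.noise j x|) ^ 2) m.P := by
  have := m.isProb
  have h := ((integrable_const (4 : ℝ)).add ((hid.integrable_noise j).abs.const_mul 4)).add
    (hid.integrable_noise_sq j)
  refine h.congr (Eventually.of_forall fun x => ?_)
  simp only [Pi.add_apply]
  rw [add_sq, sq_abs]
  ring

variable {C η : ℝ} {k j : Fin p}

theorem isFeatureSeries_of_mem_classF (hb : IsBoundedBasis b m.P) (hη : 1 < η) (hkj : k ≠ j)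
    {f : ℝ → ℝ} (hf : f ∈ classF b m.P C η k j) :
    IsFeatureSeries (feature m b j) featureWeight C fun x => f (x k) := by
  have := m.isProb
  obtain ⟨β, hβ, rfl⟩ := hf
  have hs := hβ.summable_abs hη
  have hinj : Function.Injective fun r : ℕ => ((some (some k) : Option (Option (Fin p))), r) :=
    fun r r' h => (Prod.mk.inj h).2
  let γ : Option (Option (Fin p)) × ℕ → ℝ := fun a => if a.1 = some (some k) then β a.2 else 0
  have hγ0 : ∀ a, a ∉ Set.range (fun r : ℕ => ((some (some k) : Option (Option (Fin p))), r)) →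
      γ a = 0 := fun a ha => if_neg fun h => ha ⟨a.2, by rw [← h]⟩
  have h1 : HasSum (fun a => |γ a| * featureWeight a) (∑' r : ℕ, |β r| * ((r : ℝ) + 1)) := by
    rw [← hinj.hasSum_iff fun a ha => by simp [hγ0 a ha]]
    simpa [Function.comp_def, γ, featureWeight] using (hβ.weighted hη).1.hasSum
  refine ⟨(hb.continuous_seriesFun hkj hs).measurable.comp (measurable_pi_apply k), γ,
    h1.summable, h1.tsum_eq.le.trans (hβ.weighted hη).2, fun x => ?_⟩
  rw [← hinj.hasSum_iff fun a ha => by simp [hγ0 a ha]]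
  simpa [Function.comp_def, γ, feature, hkj] using hb.hasSum_seriesFun hkj hs (x k)

theorem integral_eq_zero_of_mem_classF (hb : IsBoundedBasis b m.P) (hη : 1 < η) (hkj : k ≠ j)
    {f : ℝ → ℝ} (hf : f ∈ classF b m.P C η k j) :
    Integrable (fun x => f (x k)) m.P ∧ ∫ x, f (x k) ∂m.P = 0 := by
  have := m.isProb
  obtain ⟨β, hβ, rfl⟩ := hf
  exact hb.integral_seriesFun hkj (hβ.summable_abs hη)

theorem isFeatureSeries_noise (hid : m.Identifiable) (j : Fin p) :
    IsFeatureSeries (feature m b j) featureWeight 1 (m.noise j) :=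
  IsFeatureSeries.feature (φ := feature m b j) (some none, 0) (hid.measurable_noise j)
    (by simp [featureWeight])

/-- The standing assumptions at a fixed sample size that the deterministic analysis uses. -/
structure Regular (m : CausalAdditiveModel p) (b : ℕ → Fin p → Fin p → ℝ → ℝ)
    (S : Finset (Fin p × Fin p)) (K : ℕ) (C η : ℝ) : Prop where
  identifiable : m.Identifiable
  loopless : ∀ j, (j, j) ∉ S
  subset : m.E ⊆ S
  sparse : ∀ j, (parents S j).card ≤ K
  one_lt : 1 < η
  basis : IsBoundedBasis b m.P
  mem_classF : ∀ k j, k ≠ j → m.f k j ∈ classF b m.P C η k j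
  nonneg : 0 ≤ C

namespace Regular

variable {S : Finset (Fin p × Fin p)} {K : ℕ}

theorem ne_of_mem (h : Regular m b S K C η) (hkj : (k, j) ∈ S) : k ≠ j := by
  rintro rfl; exact h.loopless k hkj

theorem parents_subset (h : Regular m b S K C η) (j : Fin p) : parents m.E j ⊆ parents S j :=
  fun _ hk => mem_parents.2 (h.subset (mem_parents.1 hk))

theorem card_le (h : Regular m b S K C η) {g : Finset (Fin p)} (hg : g ⊆ parents S j) :
    (g.card : ℝ) ≤ K :=
  Nat.cast_le.2 ((Finset.card_le_card hg).trans (h.sparse j))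

theorem isFeatureSeries_sum (h : Regular m b S K C η) {g : Finset (Fin p)}
    (hg : g ⊆ parents S j) {F : Fin p → ℝ → ℝ} (hF : ∀ k ∈ g, F k ∈ classF b m.P C η k j) :
    IsFeatureSeries (feature m b j) featureWeight (K * C) fun x => ∑ k ∈ g, F k (x k) :=
  (IsFeatureSeries.sum featureWeight_nonneg g fun k hk =>
    isFeatureSeries_of_mem_classF h.basis h.one_lt (h.ne_of_mem (mem_parents.1 (hg hk)))
      (hF k hk)).mono (mul_le_mul_of_nonneg_right (h.card_le hg) h.nonneg)

theorem integral_sum (h : Regular m b S K C η) {g : Finset (Fin p)}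
    (hg : g ⊆ parents S j) {F : Fin p → ℝ → ℝ} (hF : ∀ k ∈ g, F k ∈ classF b m.P C η k j) :
    Integrable (fun x => ∑ k ∈ g, F k (x k)) m.P ∧ ∫ x, ∑ k ∈ g, F k (x k) ∂m.P = 0 := by
  have hi := fun k (hk : k ∈ g) => integral_eq_zero_of_mem_classF h.basis h.one_lt
    (h.ne_of_mem (mem_parents.1 (hg hk))) (hF k hk)
  refine ⟨integrable_finsetSum _ fun k hk => (hi k hk).1, ?_⟩
  rw [integral_finsetSum _ fun k hk => (hi k hk).1]
  exact Finset.sum_eq_zero fun k hk => (hi k hk).2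

theorem f_mem (h : Regular m b S K C η) (k : Fin p) (hk : k ∈ parents m.E j) :
    m.f k j ∈ classF b m.P C η k j :=
  h.mem_classF k j (h.ne_of_mem (h.subset (mem_parents.1 hk)))

/-- The residual is the noise plus the true signal minus the fitted one; the three series have norms
`1`, `KC` and `KC`. -/
theorem isFeatureSeries_residual (h : Regular m b S K C η) {g : Finset (Fin p)}
    (hg : g ⊆ parents S j) {F : Fin p → ℝ → ℝ} (hF : ∀ k ∈ g, F k ∈ classF b m.P C η k j) :
    IsFeatureSeries (feature m b j) featureWeight (1 + 2 * (K * C))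
      fun x => x j - ∑ k ∈ g, F k (x k) := by
  have h1 := ((isFeatureSeries_noise (b := b) h.identifiable j).add featureWeight_nonneg
    (h.isFeatureSeries_sum (h.parents_subset j) h.f_mem)).add featureWeight_nonneg
    (h.isFeatureSeries_sum hg hF).neg
  have e : (fun x : Fin p → ℝ => x j - ∑ k ∈ g, F k (x k)) = fun x => m.noise j x +
      ∑ k ∈ parents m.E j, m.f k j (x k) + -∑ k ∈ g, F k (x k) := by
    funext x; simp only [CausalAdditiveModel.noise]; ring
  rw [e]
  exact h1.mono (by linarith)

theorem integral_residual (h : Regular m b S K C η) {g : Finset (Fin p)}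
    (hg : g ⊆ parents S j) {F : Fin p → ℝ → ℝ} (hF : ∀ k ∈ g, F k ∈ classF b m.P C η k j) :
    ∫ x, (x j - ∑ k ∈ g, F k (x k)) ∂m.P = 0 := by
  obtain ⟨i1, e1⟩ := h.integral_sum (h.parents_subset j) h.f_mem
  obtain ⟨i2, e2⟩ := h.integral_sum hg hF
  have e : ∀ x : Fin p → ℝ, x j - ∑ k ∈ g, F k (x k) = m.noise j x +
      ∑ k ∈ parents m.E j, m.f k j (x k) - ∑ k ∈ g, F k (x k) := by
    intro x; simp only [CausalAdditiveModel.noise]; ring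
  have i3 : Integrable (fun x => m.noise j x + ∑ k ∈ parents m.E j, m.f k j (x k)) m.P :=
    (h.identifiable.integrable_noise j).add i1
  simp_rw [e]
  rw [integral_sub i3 i2, integral_add (h.identifiable.integrable_noise j) i1, e1, e2,
    h.identifiable.integral_noise]
  simp

/-- Deviations of residuals on good samples. -/
theorem abs_empDev_residual_le (h : Regular m b S K C η) {n : ℕ} {A : ℝ} (hA : 0 ≤ A)
    {x : Fin n → Fin p → ℝ} (hx : x ∈ goodSamples m.P n (feature m b) A) {g : Finset (Fin p)}
    (hg : g ⊆ parents S j) {F : Fin p → ℝ → ℝ} (hF : ∀ k ∈ g, F k ∈ classF b m.P C η k j) :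
    |(n : ℝ)⁻¹ * ∑ i, (x i j - ∑ k ∈ g, F k (x i k))| ≤ A * (1 + 2 * (K * C)) ∧
      |(n : ℝ)⁻¹ * ∑ i, (x i j - ∑ k ∈ g, F k (x i k)) ^ 2 -
        ∫ y, (y j - ∑ k ∈ g, F k (y k)) ^ 2 ∂m.P| ≤ A * (1 + 2 * (K * C)) ^ 2 := by
  have hC := h.nonneg
  obtain ⟨h1, h2⟩ := (h.isFeatureSeries_residual hg hF).abs_empDev_sq_le one_le_featureWeight
    (measurable_feature h.identifiable h.basis j) (integrable_envelope h.identifiable j)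
    (abs_feature_mul_le h.basis j) hA (by positivity) (hx j)
  constructor
  · have h3 := h1 (none, 0)
    simp only [feature, one_mul, empDev, h.integral_residual hg hF, sub_zero, featureWeight,
      Nat.cast_zero, zero_add, mul_one] at h3
    exact h3
  · simp only [empDev, ← sq] at h2
    rw [sq (1 + _), ← mul_assoc]
    exact h2

theorem residualVar_le (b : ℕ → Fin p → Fin p → ℝ → ℝ) (C η : ℝ) {g : Finset (Fin p)}
    {F : Fin p → ℝ → ℝ} (hF : ∀ k ∈ g, F k ∈ classF b m.P C η k j) :
    residualVar b m.P C η j g ≤ ∫ y, (y j - ∑ k ∈ g, F k (y k)) ^ 2 ∂m.P := by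
  refine csInf_le ⟨0, ?_⟩ ⟨F, hF, rfl⟩
  rintro v ⟨f, -, rfl⟩
  exact integral_nonneg fun _ => sq_nonneg _

theorem residualVar_parents_le (h : Regular m b S K C η) (j : Fin p) :
    residualVar b m.P C η j (parents m.E j) ≤ m.σ j ^ 2 := by
  have := residualVar_le (m := m) b C η (j := j) h.f_mem
  rwa [← h.identifiable.integral_noise_sq j]

/-- The residual variance is bounded. -/
theorem residualVar_le_const (h : Regular m b S K C η) (g : Finset (Fin p)) {σbar : ℝ}
    (hσ : m.σ j ^ 2 ≤ σbar ^ 2) (hg : g ⊆ parents S j) :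
    residualVar b m.P C η j g ≤ (1 + 2 * (K * C)) ^ 2 * (8 + 2 * σbar ^ 2) := by
  have hC := h.nonneg
  have := m.isProb
  have h0 : ∀ k ∈ g, (fun _ : Fin p => (0 : ℝ → ℝ)) k ∈ classF b m.P C η k j := fun k _ =>
    ⟨0, InEllipsoid.zero hC, seriesFun_zero.symm⟩
  have hs := h.isFeatureSeries_residual hg h0
  refine (residualVar_le b C η h0).trans ?_
  set B := 1 + 2 * (K * C)
  have hB : 0 ≤ B := by positivity
  -- The competitor is the zero fit. As a feature series of norm at most `B`, the variable `X_j` is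
  -- bounded by `B (2 + |ε_j|)`.
  have hpt : ∀ x : Fin p → ℝ, (x j - ∑ k ∈ g, (0 : ℝ → ℝ) (x k)) ^ 2 ≤
      B ^ 2 * (8 + 2 * m.noise j x ^ 2) := fun x => by
    have h1 := hs.abs_mul_le one_le_featureWeight (c := 1) (x := x) (V := 2 + |m.noise j x|)
      (by positivity) fun a => by rw [one_mul]; exact abs_feature_le h.basis j x a
    rw [one_mul] at h1
    have h2 : (x j - ∑ k ∈ g, (0 : ℝ → ℝ) (x k)) ^ 2 ≤ (B * (2 + |m.noise j x|)) ^ 2 := by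
      rw [← sq_abs]; exact pow_le_pow_left₀ (abs_nonneg _) h1 2
    refine h2.trans ?_
    rw [mul_pow]
    refine mul_le_mul_of_nonneg_left ?_ (sq_nonneg _)
    nlinarith [sq_nonneg (2 - |m.noise j x|), sq_abs (m.noise j x)]
  have hi : Integrable (fun x => B ^ 2 * (8 + 2 * m.noise j x ^ 2)) m.P :=
    ((integrable_const _).add ((h.identifiable.integrable_noise_sq j).const_mul 2)).const_mul _
  refine (integral_mono_of_nonneg (Eventually.of_forall fun _ => sq_nonneg _) hi
    (Eventually.of_forall hpt)).trans ?_
  rw [integral_const_mul, integral_add (integrable_const _)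
    ((h.identifiable.integrable_noise_sq j).const_mul 2), integral_const_mul,
    h.identifiable.integral_noise_sq]
  simp only [integral_const, probReal_univ, smul_eq_mul, one_mul]
  gcongr

/-- A residual of a model with parents in `g`, with an arbitrary intercept, has empirical second
moment not much below the residual variance. -/
theorem residualVar_sub_le_empirical (h : Regular m b S K C η) {n : ℕ} (hn : 0 < n) {A : ℝ}
    (hA : 0 ≤ A) {x : Fin n → Fin p → ℝ} (hx : x ∈ goodSamples m.P n (feature m b) A)
    {g : Finset (Fin p)} (hg : g ⊆ parents S j) {F : Fin p → ℝ → ℝ}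
    (hF : ∀ k ∈ g, F k ∈ classF b m.P C η k j) (d : ℝ) :
    residualVar b m.P C η j g - (A + A ^ 2) * (1 + 2 * (K * C)) ^ 2 ≤
      (n : ℝ)⁻¹ * ∑ i, (x i j + d - ∑ k ∈ g, F k (x i k)) ^ 2 := by
  have hn' : (n : ℝ) ≠ 0 := Nat.cast_ne_zero.2 hn.ne'
  obtain ⟨h1, h2⟩ := h.abs_empDev_residual_le hA hx hg hF
  have h3 := residualVar_le (m := m) b C η (j := j) hF
  set M := (n : ℝ)⁻¹ * ∑ i, (x i j - ∑ k ∈ g, F k (x i k)) with hM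
  -- Completing the square, the intercept contributes `(d + M)² - M² ≥ -M²`. This is the origin of
  -- the term `A²` next to `A`.
  have e : (n : ℝ)⁻¹ * ∑ i, (x i j + d - ∑ k ∈ g, F k (x i k)) ^ 2 =
      (n : ℝ)⁻¹ * ∑ i, (x i j - ∑ k ∈ g, F k (x i k)) ^ 2 + 2 * d * M + d ^ 2 := by
    have e1 : ∀ i, (x i j + d - ∑ k ∈ g, F k (x i k)) ^ 2 =
        (x i j - ∑ k ∈ g, F k (x i k)) ^ 2 + 2 * d * (x i j - ∑ k ∈ g, F k (x i k)) + d ^ 2 :=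
      fun i => by ring
    simp_rw [e1]
    rw [Finset.sum_add_distrib, Finset.sum_add_distrib, ← Finset.mul_sum, hM]
    simp only [Finset.sum_const, Finset.card_univ, Fintype.card_fin, nsmul_eq_mul]
    field_simp
  have h4 : M ^ 2 ≤ A ^ 2 * (1 + 2 * (K * C)) ^ 2 := by
    rw [← mul_pow, ← sq_abs]; exact pow_le_pow_left₀ (abs_nonneg _) h1 2
  rw [e]
  nlinarith [sq_nonneg (d + M), (abs_le.1 h2).1]

/-- The truncated true model has empirical residual variance not much above the noise variance. -/
theorem empirical_truncation_le (h : Regular m b S K C η) {n : ℕ} {A : ℝ}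
    (hA : 0 ≤ A) {x : Fin n → Fin p → ℝ} (hx : x ∈ goodSamples m.P n (feature m b) A)
    {R : ℕ} (hR : 0 < R) {β : ℕ → Fin p → Fin p → ℝ}
    (hβ : ∀ k ∈ parents m.E j, InEllipsoid C η (fun r => β r k j) ∧
      m.f k j = seriesFun b m.P (fun r => β r k j) k j)
    (hβ' : CoefBound C η fun (r : Fin R) k j => β r k j) :
    (n : ℝ)⁻¹ * ∑ i, (x i j - ∑ k ∈ parents m.E j,
        truncFun b m.P (fun (r : Fin R) k j => β r k j) k j (x i k)) ^ 2 ≤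
      m.σ j ^ 2 + K * (2 * C) ^ 2 * ((parents m.E j).card * (R : ℝ) ^ (-2 * η)) +
        A * (1 + 2 * (K * C)) ^ 2 := by
  have := m.isProb
  have hC := h.nonneg
  set F : Fin p → ℝ → ℝ := fun k => truncFun b m.P (fun (r : Fin R) k j => β r k j) k j with hFdef
  have hne : ∀ k ∈ parents m.E j, k ≠ j := fun k hk => h.ne_of_mem (h.subset (mem_parents.1 hk))
  have hF : ∀ k ∈ parents m.E j, F k ∈ classF b m.P C η k j := fun k hk =>
    truncFun_mem_classF hβ' (hne k hk)
  have h2 := (abs_le.1 (h.abs_empDev_residual_le hA hx (h.parents_subset j) hF).2).2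
  set ρ := (R : ℝ) ^ (-η) with hρ
  have hρ2 : (R : ℝ) ^ (-2 * η) = ρ ^ 2 := by
    rw [hρ, ← Real.rpow_natCast, ← Real.rpow_mul (Nat.cast_nonneg R)]; ring_nf
  set D : Fin p → ℝ → ℝ := fun k t => m.f k j t - F k t with hD
  have hDm : ∀ k ∈ parents m.E j, Measurable (D k) := fun k hk =>
    ((h.identifiable.continuous_f k j).measurable).sub (by
      simp only [hFdef, truncFun_eq_seriesFun]
      exact (h.basis.continuous_seriesFun (hne k hk)
        ((hβ'.inEllipsoid (hne k hk)).summable_abs h.one_lt)).measurable)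
  set Q : (Fin p → ℝ) → ℝ := fun y => ∑ k ∈ parents m.E j, D k (y k) with hQ
  have hQm : Measurable Q := Finset.measurable_sum _ fun k hk =>
    (hDm k hk).comp (measurable_pi_apply k)
  have hQabs : ∀ y, |Q y| ≤ (parents m.E j).card * (2 * C * ρ) := fun y => by
    refine (Finset.abs_sum_le_sum_abs _ _).trans ?_
    rw [← nsmul_eq_mul]
    refine Finset.sum_le_card_nsmul _ _ _ fun k hk => ?_
    simp only [hD, (hβ k hk).2]
    exact h.basis.abs_seriesFun_sub_truncFun_le h.one_lt (hne k hk) (hβ k hk).1 hR (y k)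
  set q := ((parents m.E j).card : ℝ) * (2 * C * ρ) with hq
  have hQsq : ∀ y, Q y ^ 2 ≤ q ^ 2 := fun y => by
    rw [← sq_abs]; exact pow_le_pow_left₀ (abs_nonneg _) (hQabs y) 2
  have hQi : Integrable (fun y => Q y ^ 2) m.P :=
    (integrable_const (q ^ 2)).mono' (hQm.pow_const 2).aestronglyMeasurable
      (Eventually.of_forall fun y => by
        rw [Real.norm_eq_abs, abs_of_nonneg (sq_nonneg _)]; exact hQsq y)
  have hNQ : Integrable (fun y => m.noise j y * Q y) m.P :=
    ((h.identifiable.integrable_noise j).mul_const q).abs.mono'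
      ((h.identifiable.measurable_noise j).mul hQm).aestronglyMeasurable
      (Eventually.of_forall fun y => by
        rw [norm_mul, abs_mul, Real.norm_eq_abs, Real.norm_eq_abs]
        exact mul_le_mul_of_nonneg_left ((hQabs y).trans (le_abs_self _)) (abs_nonneg _))
  -- The truncation error `Q` depends only on the parents, hence is uncorrelated with the noise.
  -- Without the cross term the bias enters squared, which gives the rate `R^(-2η)`.
  have hI : ∫ y, (y j - ∑ k ∈ parents m.E j, F k (y k)) ^ 2 ∂m.P =
      m.σ j ^ 2 + ∫ y, Q y ^ 2 ∂m.P := by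
    have e : ∀ y : Fin p → ℝ, (y j - ∑ k ∈ parents m.E j, F k (y k)) ^ 2 =
        m.noise j y ^ 2 + 2 * (m.noise j y * Q y) + Q y ^ 2 := fun y => by
      have : y j - ∑ k ∈ parents m.E j, F k (y k) = m.noise j y + Q y := by
        simp only [hQ, hD, Finset.sum_sub_distrib, CausalAdditiveModel.noise]; ring
      rw [this]; ring
    simp_rw [e]
    have i1 : Integrable (fun y => m.noise j y ^ 2 + 2 * (m.noise j y * Q y)) m.P :=
      (h.identifiable.integrable_noise_sq j).add (hNQ.const_mul 2)
    rw [integral_add i1 hQi, integral_add (h.identifiable.integrable_noise_sq j)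
      (hNQ.const_mul 2), integral_const_mul, h.identifiable.integral_noise_mul_parents j hDm,
      h.identifiable.integral_noise_sq]
    ring
  have hQint : ∫ y, Q y ^ 2 ∂m.P ≤ q ^ 2 := by
    refine (integral_mono hQi (integrable_const _) hQsq).trans ?_
    simp
  -- Only one of the two factors `card` is bounded by `K`; the other is kept because it sums over
  -- `j` to the number of edges.
  have hqK : q ^ 2 ≤ K * (2 * C) ^ 2 * ((parents m.E j).card * (R : ℝ) ^ (-2 * η)) := by
    rw [hρ2]
    have hcK := h.card_le (h.parents_subset j)
    have : 0 ≤ ((parents m.E j).card : ℝ) * ((2 * C) ^ 2 * ρ ^ 2) := by positivity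
    calc q ^ 2 = (parents m.E j).card * ((parents m.E j).card * ((2 * C) ^ 2 * ρ ^ 2)) := by
          rw [hq]; ring
      _ ≤ K * ((parents m.E j).card * ((2 * C) ^ 2 * ρ ^ 2)) :=
          mul_le_mul_of_nonneg_right hcK this
      _ = _ := by ring
  linarith

end Regular

end Features

/-! ### Comparison of objective values -/

section Objective

variable {n p R : ℕ} {m : CausalAdditiveModel p} {b : ℕ → Fin p → Fin p → ℝ → ℝ}
  {P : Measure (Fin p → ℝ)} {S : Finset (Fin p × Fin p)} {K : ℕ} {C η : ℝ} {j k : Fin p}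

theorem mem_coefGraph {β : Fin R → Fin p → Fin p → ℝ} :
    (k, j) ∈ coefGraph β ↔ k ≠ j ∧ ∃ r, β r k j ≠ 0 := by
  classical
  simp only [coefGraph, Finset.mem_filter, Finset.mem_univ, true_and, ne_eq]
  refine and_congr_right fun _ => ?_
  rw [Finset.sum_eq_zero_iff_of_nonneg fun r _ => by positivity]
  simp

theorem truncFun_eq_zero {β : Fin R → Fin p → Fin p → ℝ} (hβ : ∀ r, β r k j = 0) :
    truncFun b P β k j = 0 := by
  funext t; simp [truncFun, intercept, hβ]

variable (b P) in
/-- The empirical residual variance at node `j`, with an additional intercept `d`. -/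
noncomputable def empResidual (x : Fin n → Fin p → ℝ) (β : Fin R → Fin p → Fin p → ℝ) (j : Fin p)
    (d : ℝ) : ℝ :=
  (n : ℝ)⁻¹ * ∑ i, (x i j + d - ∑ k ∈ Finset.univ.erase j, truncFun b P β k j (x i k)) ^ 2

theorem sum_erase_truncFun_eq {β : Fin R → Fin p → Fin p → ℝ} {g : Finset (Fin p)} (hj : j ∉ g)
    (hg : ∀ k, (k, j) ∈ coefGraph β → k ∈ g) (y : Fin p → ℝ) :
    ∑ k ∈ Finset.univ.erase j, truncFun b P β k j (y k) = ∑ k ∈ g, truncFun b P β k j (y k) := by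
  refine (Finset.sum_subset (fun k hk => ?_) fun k hk hkg => ?_).symm
  · exact Finset.mem_erase.2 ⟨fun h => hj (h ▸ hk), Finset.mem_univ k⟩
  · have hkj := (Finset.mem_erase.1 hk).1
    have hβ : ∀ r, β r k j = 0 := fun r => by
      by_contra h
      exact hkg (hg k (mem_coefGraph.2 ⟨hkj, r, h⟩))
    rw [truncFun_eq_zero hβ]; rfl

theorem precedingParents_subset (S : Finset (Fin p × Fin p)) (π : Equiv.Perm (Fin p))
    (j : Fin p) : precedingParents S π j ⊆ parents S j := fun k hk => by
  simp only [precedingParents, Finset.mem_filter, Finset.mem_univ, true_and] at hk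
  exact mem_parents.2 hk.2

/-- This replaces the estimated graph by its ordering: the fit at `j` uses only candidate parents
preceding `j`, so its risk is at least the residual variance in the definition of the separation. -/
theorem mem_precedingParents_of_consistent {G : Finset (Fin p × Fin p)} (hG : G ⊆ S)
    {π : Equiv.Perm (Fin p)} (hπ : π ∈ consistentPerms G) (hkj : (k, j) ∈ G) :
    k ∈ precedingParents S π j := by
  simp only [precedingParents, Finset.mem_filter, Finset.mem_univ, true_and]
  exact ⟨hπ _ _ (by simpa using hkj), hG hkj⟩

/-- Coefficients of the true functions. -/
def IsTrueCoef (m : CausalAdditiveModel p) (b : ℕ → Fin p → Fin p → ℝ → ℝ) (C η : ℝ)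
    (β : ℕ → Fin p → Fin p → ℝ) : Prop :=
  (∀ k j, (k, j) ∈ m.E → InEllipsoid C η (fun r => β r k j) ∧
    m.f k j = seriesFun b m.P (fun r => β r k j) k j) ∧ ∀ k j, (k, j) ∉ m.E → ∀ r, β r k j = 0

theorem IsTrueCoef.coefGraph_subset {β : ℕ → Fin p → Fin p → ℝ} (hβ : IsTrueCoef m b C η β) :
    coefGraph (fun (r : Fin R) k j => β r k j) ⊆ m.E := by
  rintro ⟨k, j⟩ hkj
  by_contra h
  obtain ⟨-, r, hr⟩ := mem_coefGraph.1 hkj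
  exact hr (hβ.2 k j h r)

theorem IsTrueCoef.coefBound {β : ℕ → Fin p → Fin p → ℝ} (hβ : IsTrueCoef m b C η β)
    (hC : 0 ≤ C) : CoefBound C η fun (r : Fin R) k j => β r k j := by
  intro k j _
  by_cases h : (k, j) ∈ m.E
  · obtain ⟨h1, h2⟩ := (hβ.1 k j h).1
    refine le_trans ?_ h2
    rw [Fin.sum_univ_eq_sum_range fun r : ℕ => |β r k j| * ((r : ℝ) + 1) ^ η]
    exact h1.sum_le_tsum _ fun r _ => by positivity
  · simpa [hβ.2 k j h] using hC

namespace Regular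

theorem exists_isTrueCoef (h : Regular m b S K C η) : ∃ β, IsTrueCoef m b C η β := by
  classical
  have hex : ∀ k j, (k, j) ∈ m.E → ∃ β, InEllipsoid C η β ∧ m.f k j = seriesFun b m.P β k j :=
    fun k j hkj => h.mem_classF k j (h.ne_of_mem (h.subset hkj))
  choose! β hβ using hex
  refine ⟨fun r k j => if (k, j) ∈ m.E then β k j r else 0, fun k j hkj => ?_,
    fun k j hkj r => if_neg hkj⟩
  simpa only [hkj, if_true] using hβ k j hkj

/-- Lower bound on the empirical residual variances of a feasible model. -/
theorem residualVar_sub_le_empResidual (h : Regular m b S K C η) (hn : 0 < n) {A : ℝ}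
    (hA : 0 ≤ A) {x : Fin n → Fin p → ℝ} (hx : x ∈ goodSamples m.P n (feature m b) A)
    {β : Fin R → Fin p → Fin p → ℝ} (hβ : CoefBound C η β) (hβS : coefGraph β ⊆ S)
    {π : Equiv.Perm (Fin p)} (hπ : π ∈ consistentPerms (coefGraph β)) (j : Fin p) (d : ℝ) :
    residualVar b m.P C η j (precedingParents S π j) - (A + A ^ 2) * (1 + 2 * (K * C)) ^ 2 ≤
      empResidual b m.P x β j d := by
  have hg := precedingParents_subset S π j
  have hne : ∀ k ∈ precedingParents S π j, k ≠ j := fun k hk =>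
    h.ne_of_mem (mem_parents.1 (hg hk))
  unfold empResidual
  simp_rw [sum_erase_truncFun_eq (fun hj => hne j hj rfl)
    fun k hk => mem_precedingParents_of_consistent hβS hπ hk]
  exact h.residualVar_sub_le_empirical hn hA hx hg
    (fun k hk => truncFun_mem_classF hβ (hne k hk)) d

/-- Upper bound on the empirical residual variances of the truncated true model. -/
theorem empResidual_isTrueCoef_le (h : Regular m b S K C η) {A : ℝ}
    (hA : 0 ≤ A) {x : Fin n → Fin p → ℝ} (hx : x ∈ goodSamples m.P n (feature m b) A)
    (hR : 0 < R) {β : ℕ → Fin p → Fin p → ℝ} (hβ : IsTrueCoef m b C η β) (j : Fin p) :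
    empResidual b m.P x (fun (r : Fin R) k j => β r k j) j 0 ≤
      m.σ j ^ 2 + K * (2 * C) ^ 2 * ((parents m.E j).card * (R : ℝ) ^ (-2 * η)) +
        A * (1 + 2 * (K * C)) ^ 2 := by
  unfold empResidual
  simp_rw [sum_erase_truncFun_eq (g := parents m.E j)
    (fun hj => h.ne_of_mem (h.subset (mem_parents.1 hj)) rfl)
    (fun k hk => mem_parents.2 (hβ.coefGraph_subset hk)), add_zero]
  exact h.empirical_truncation_le hA hx hR (fun k hk => hβ.1 k j (mem_parents.1 hk))
    (hβ.coefBound h.nonneg)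

end Regular

theorem sum_card_parents (E : Finset (Fin p × Fin p)) : ∑ j, (parents E j).card = E.card := by
  rw [← Finset.card_sigma]
  refine Finset.card_bij (fun a _ => (a.2, a.1)) (fun a ha => ?_) (fun a _ a' _ haa => ?_)
    fun e he => ⟨⟨e.2, e.1⟩, by simpa [mem_parents] using he, rfl⟩
  · exact mem_parents.1 (Finset.mem_sigma.1 ha).2
  · obtain ⟨h1, h2⟩ := Prod.mk.inj haa
    exact Sigma.ext h2 (heq_of_eq h1)

variable (m b S C η) in
/-- The total log-likelihood gap of the ordering `π`. -/
noncomputable def orderGap (π : Equiv.Perm (Fin p)) : ℝ :=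
  ∑ j, (Real.log (residualVar b m.P C η j (precedingParents S π j)) - Real.log (m.σ j ^ 2))

/-- The basic inequality: if a feasible model does not have a larger objective value than the
truncated true model plus `τ`, then the gap of its ordering is small. -/
theorem Regular.orderGap_le (h : Regular m b S K C η) {A : ℝ}
    (hA : 0 ≤ A) {x : Fin n → Fin p → ℝ} (hx : x ∈ goodSamples m.P n (feature m b) A)
    (hR : 0 < R) {cmin : ℝ} (hcmin : 0 < cmin)
    (hν : ∀ j, ∀ g ⊆ parents S j, cmin ≤ residualVar b m.P C η j g)
    (hΔ : (A + A ^ 2) * (1 + 2 * (K * C)) ^ 2 ≤ cmin / 2) {s lam τ : ℝ} (hs : (m.E.card : ℝ) ≤ s)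
    {β : ℕ → Fin p → Fin p → ℝ} (hβ : IsTrueCoef m b C η β) {π : Equiv.Perm (Fin p)}
    {ρ : Fin p → ℝ} (hρ : ∀ j, residualVar b m.P C η j (precedingParents S π j) -
      (A + A ^ 2) * (1 + 2 * (K * C)) ^ 2 ≤ ρ j)
    (hcmp : ∑ j, (1 + Real.log (ρ j)) ≤ ∑ j, Real.log (m.σ j ^ 2) +
      ∑ j, empResidual b m.P x (fun (r : Fin R) k j => β r k j) j 0 / m.σ j ^ 2 +
        lam ^ 2 * m.E.card + τ) :
    orderGap m b S C η π ≤ 3 * (A + A ^ 2) * (1 + 2 * (K * C)) ^ 2 / cmin * p +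
      K * (2 * C) ^ 2 / cmin * (s * (R : ℝ) ^ (-2 * η)) + lam ^ 2 * s + τ := by
  set Δ := (A + A ^ 2) * (1 + 2 * (K * C)) ^ 2 with hΔdef
  have hΔ0 : 0 ≤ Δ := by positivity
  have hRη : 0 ≤ (R : ℝ) ^ (-2 * η) := by positivity
  -- Since `Δ ≤ cmin / 2 ≤ ν / 2`, passing from `ν` to `ν - Δ` costs at most `Δ / (ν - Δ) ≤ 2Δ /
  -- cmin` in the logarithm.
  have hlog : ∀ j, Real.log (residualVar b m.P C η j (precedingParents S π j)) -
      2 * Δ / cmin ≤ Real.log (ρ j) := fun j => by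
    set ν := residualVar b m.P C η j (precedingParents S π j)
    have hνj : cmin ≤ ν := hν j _ (precedingParents_subset S π j)
    have h1 : 0 < ν - Δ := by linarith
    have h2 : Real.log (ν - Δ) ≤ Real.log (ρ j) := Real.log_le_log h1 (hρ j)
    have h3 : Real.log (ν / (ν - Δ)) ≤ ν / (ν - Δ) - 1 :=
      Real.log_le_sub_one_of_pos (div_pos (by linarith) h1)
    rw [Real.log_div (by linarith) h1.ne'] at h3
    have h4 : ν / (ν - Δ) - 1 ≤ 2 * Δ / cmin := by
      rw [div_sub_one h1.ne', div_le_div_iff₀ h1 hcmin]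
      nlinarith
    linarith
  have hup : ∀ j, empResidual b m.P x (fun (r : Fin R) k j => β r k j) j 0 / m.σ j ^ 2 ≤
      1 + Δ / cmin + K * (2 * C) ^ 2 / cmin * ((parents m.E j).card * (R : ℝ) ^ (-2 * η)) :=
    fun j => by
    have h1 := h.empResidual_isTrueCoef_le hA hx hR hβ j
    -- The true functions are admissible in the infimum defining `ν_j` at the true parents, so the
    -- lower bound on residual variances also bounds the noise variance from below.
    have hσ : cmin ≤ m.σ j ^ 2 :=
      (hν j _ (h.parents_subset j)).trans (h.residualVar_parents_le j)
    have hσ0 : 0 < m.σ j ^ 2 := hcmin.trans_le hσ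
    have hAΔ : A * (1 + 2 * (K * C)) ^ 2 ≤ Δ := by
      rw [hΔdef]; gcongr; nlinarith [sq_nonneg A]
    set W := K * (2 * C) ^ 2 * ((parents m.E j).card * (R : ℝ) ^ (-2 * η)) with hW
    have hW0 : 0 ≤ W := by positivity
    have h2 : (Δ + W) / m.σ j ^ 2 ≤ (Δ + W) / cmin := by gcongr
    calc _ ≤ (m.σ j ^ 2 + (Δ + W)) / m.σ j ^ 2 := by gcongr; linarith
      _ = 1 + (Δ + W) / m.σ j ^ 2 := by rw [add_div, div_self hσ0.ne']
      _ ≤ 1 + (Δ + W) / cmin := by linarith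
      _ = _ := by rw [hW]; ring
  have hsum1 := Finset.sum_le_sum fun j (_ : j ∈ Finset.univ) => hlog j
  have hsum2 := Finset.sum_le_sum fun j (_ : j ∈ Finset.univ) => hup j
  have hcard : ∑ j, ((parents m.E j).card : ℝ) = m.E.card := by
    exact_mod_cast sum_card_parents m.E
  rw [Finset.sum_add_distrib, ← Finset.mul_sum, ← Finset.sum_mul, hcard] at hsum2
  rw [Finset.sum_sub_distrib] at hsum1
  rw [Finset.sum_add_distrib] at hcmp
  simp only [Finset.sum_const, Finset.card_univ, Fintype.card_fin, nsmul_eq_mul] at hsum1 hsum2 hcmp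
  have hl : lam ^ 2 * m.E.card ≤ lam ^ 2 * s := by gcongr
  have hsR : K * (2 * C) ^ 2 / cmin * (m.E.card * (R : ℝ) ^ (-2 * η)) ≤
      K * (2 * C) ^ 2 / cmin * (s * (R : ℝ) ^ (-2 * η)) := by gcongr
  -- Two units of `Δ / cmin` per node come from the lower bound and one from the true model; the
  -- summands `1` cancel between the two sides.
  have e1 : (p : ℝ) * (2 * Δ / cmin) + p * (Δ / cmin) =
      3 * (A + A ^ 2) * (1 + 2 * (K * C)) ^ 2 / cmin * p := by rw [hΔdef]; ring
  rw [orderGap, Finset.sum_sub_distrib]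
  linarith

/-- Profiling out the scale: `log u ≤ u - 1` at `u = γ² ρ`. It serves both problems, with `γ =
1/σ_j` for the likelihood and `γ = Γ_jj` for the program. -/
theorem one_add_log_le {γ ρ : ℝ} (hγ : 0 < γ) (hρ : 0 < ρ) :
    1 + Real.log ρ ≤ -2 * Real.log γ + γ ^ 2 * ρ := by
  have h := Real.log_le_sub_one_of_pos (mul_pos (pow_pos hγ 2) hρ)
  rw [Real.log_mul (by positivity) hρ.ne', Real.log_pow] at h
  push_cast at h
  linarith

/-! ### The penalized likelihood problem -/

theorem mleObjective_eq (lam : ℝ) (x : Fin n → Fin p → ℝ) (θ : MLEPoint p R) :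
    mleObjective b P lam x θ = ∑ j, Real.log (θ.σ j ^ 2) +
      ∑ j, empResidual b P x θ.β j 0 / θ.σ j ^ 2 + lam ^ 2 * ((coefGraph θ.β).card : ℝ) := by
  simp only [mleObjective, empResidual, add_zero]

theorem le_mleObjective {lam : ℝ} {x : Fin n → Fin p → ℝ} {θ : MLEPoint p R}
    (hσ : ∀ j, 0 < θ.σ j) (hpos : ∀ j, 0 < empResidual b P x θ.β j 0) :
    ∑ j, (1 + Real.log (empResidual b P x θ.β j 0)) ≤ mleObjective b P lam x θ := by
  have h : ∑ j, (1 + Real.log (empResidual b P x θ.β j 0)) ≤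
      ∑ j, (Real.log (θ.σ j ^ 2) + empResidual b P x θ.β j 0 / θ.σ j ^ 2) :=
    Finset.sum_le_sum fun j _ => by
      have := one_add_log_le (inv_pos.2 (hσ j)) (hpos j)
      rw [Real.log_inv, inv_pow, inv_mul_eq_div] at this
      rw [Real.log_pow]
      push_cast
      linarith
  rw [mleObjective_eq, ← Finset.sum_add_distrib]
  have : 0 ≤ lam ^ 2 * ((coefGraph θ.β).card : ℝ) := by positivity
  linarith

theorem Regular.exists_mle_feasible (h : Regular m b S K C η) {s : ℝ}
    (hs : (m.E.card : ℝ) ≤ s) {β : ℕ → Fin p → Fin p → ℝ} (hβ : IsTrueCoef m b C η β) :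
    (⟨fun r k j => β r k j, m.σ⟩ : MLEPoint p R) ∈ mleFeasible C η S s :=
  ⟨m.σ_pos, m.isDAG.mono hβ.coefGraph_subset, hβ.coefBound h.nonneg,
    hβ.coefGraph_subset.trans h.subset,
    (Nat.cast_le.2 (Finset.card_le_card hβ.coefGraph_subset)).trans hs⟩

/-! ### The mixed-integer program -/

/-- Each row of `Γ` is a scaled residual. The functions get the mean-zero intercepts that put them
in the classes, and the difference from the actual intercept is collected in one free constant per
node. -/
theorem dotProduct_extVec (Γ : Matrix (Fin p) (Col p R) ℝ) (j : Fin p)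
    (hoff : ∀ k, k ≠ j → Γ j (colX R k) = 0) (hself : ∀ r, Γ j (colB r j) = 0)
    (hpos : 0 < Γ j (colX R j)) (y : Fin p → ℝ) :
    Γ j ⬝ᵥ extVec R b j y = Γ j (colX R j) * (y j + (Γ j (colOne p R) / Γ j (colX R j) +
      ∑ k ∈ Finset.univ.erase j, intercept b P (betaOf Γ) k j) -
        ∑ k ∈ Finset.univ.erase j, truncFun b P (betaOf Γ) k j (y k)) := by
  have e1 : ∑ k, Γ j (Sum.inl k) * y k = Γ j (colX R j) * y j :=
    Finset.sum_eq_single j (fun k _ hk => by rw [hoff k hk, zero_mul]) (by simp)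
  have e2 : ∑ a : Fin R × Fin p, Γ j (Sum.inr (Sum.inr a)) * b a.1 a.2 j (y a.2) =
      -(Γ j (colX R j) * ∑ k ∈ Finset.univ.erase j, ∑ r, betaOf Γ r k j * b r k j (y k)) := by
    rw [Fintype.sum_prod_type_right, ← Finset.add_sum_erase _ _ (Finset.mem_univ j)]
    have : ∑ r, Γ j (colB r j) * b r j j (y j) = 0 :=
      Finset.sum_eq_zero fun r _ => by rw [hself r, zero_mul]
    rw [this, zero_add, Finset.mul_sum, ← Finset.sum_neg_distrib]
    refine Finset.sum_congr rfl fun k _ => ?_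
    rw [Finset.mul_sum, ← Finset.sum_neg_distrib]
    refine Finset.sum_congr rfl fun r _ => ?_
    rw [betaOf]
    field_simp
  have e3 : ∑ k ∈ Finset.univ.erase j, truncFun b P (betaOf Γ) k j (y k) =
      ∑ k ∈ Finset.univ.erase j, intercept b P (betaOf Γ) k j +
        ∑ k ∈ Finset.univ.erase j, ∑ r, betaOf Γ r k j * b r k j (y k) := by
    simp only [truncFun, Finset.sum_add_distrib]
  simp only [dotProduct, Fintype.sum_sum_type, extVec, Finset.univ_unique, Finset.sum_singleton,
    mul_one]
  rw [e1, e2, e3]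
  change _ + (Γ j (colOne p R) + _) = _
  field_simp
  ring

theorem dotProduct_gram (x : Fin n → Fin p → ℝ) (j : Fin p) (v : Col p R → ℝ) :
    v ⬝ᵥ (gram R b x j).mulVec v = (n : ℝ)⁻¹ * ∑ i, (v ⬝ᵥ extVec R b j (x i)) ^ 2 := by
  rw [gram, Matrix.smul_mulVec, Matrix.sum_mulVec, dotProduct_smul, dotProduct_sum, smul_eq_mul]
  congr 1
  refine Finset.sum_congr rfl fun i _ => ?_
  rw [Matrix.vecMulVec_mulVec, dotProduct_smul, dotProduct_comm (extVec R b j (x i)), sq]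
  simp

theorem dotProduct_gram_eq (x : Fin n → Fin p → ℝ) (Γ : Matrix (Fin p) (Col p R) ℝ) (j : Fin p)
    (hoff : ∀ k, k ≠ j → Γ j (colX R k) = 0) (hself : ∀ r, Γ j (colB r j) = 0)
    (hpos : 0 < Γ j (colX R j)) :
    Γ j ⬝ᵥ (gram R b x j).mulVec (Γ j) = Γ j (colX R j) ^ 2 * empResidual b P x (betaOf Γ) j
      (Γ j (colOne p R) / Γ j (colX R j) +
        ∑ k ∈ Finset.univ.erase j, intercept b P (betaOf Γ) k j) := by
  rw [dotProduct_gram, empResidual]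
  simp_rw [dotProduct_extVec (P := P) Γ j hoff hself hpos, mul_pow]
  rw [← Finset.mul_sum]
  ring

theorem MIPFeasible.coefGraph_subset {s M : ℝ} {q : MIPPoint p R}
    (hq : MIPFeasible C η S s M q) : coefGraph (betaOf q.Γ) ⊆ S := by
  rintro ⟨k, j⟩ hkj
  by_contra h
  obtain ⟨-, r, hr⟩ := mem_coefGraph.1 hkj
  exact hr (by simp [betaOf, (hq.super k j h).2 r])

theorem MIPFeasible.le_mipObjective {s M lam : ℝ} {q : MIPPoint p R}
    (hq : MIPFeasible C η S s M q) {x : Fin n → Fin p → ℝ} {d : Fin p → ℝ}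
    (hd : ∀ j, d j = q.Γ j (colOne p R) / q.Γ j (colX R j) +
        ∑ k ∈ Finset.univ.erase j, intercept b P (betaOf q.Γ) k j)
    (hpos : ∀ j, 0 < empResidual b P x (betaOf q.Γ) j (d j)) :
    ∑ j, (1 + Real.log (empResidual b P x (betaOf q.Γ) j (d j))) ≤ mipObjective b lam x q := by
  have h : ∑ j, (1 + Real.log (empResidual b P x (betaOf q.Γ) j (d j))) ≤
      ∑ j, (-2 * Real.log (q.Γ j (colX R j)) + q.Γ j ⬝ᵥ (gram R b x j).mulVec (q.Γ j)) :=
    Finset.sum_le_sum fun j _ => by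
      rw [dotProduct_gram_eq (P := P) x q.Γ j (hq.Γ_offdiag j) (hq.Γ_self j) (hq.bigM_diag j).1,
        ← hd j]
      exact one_add_log_le (hq.bigM_diag j).1 (hpos j)
  have hg : 0 ≤ ∑ k, ∑ j, q.g k j := Finset.sum_nonneg fun k _ => Finset.sum_nonneg fun j _ => by
    rcases hq.g_binary k j with h | h <;> rw [h]; norm_num
  have := mul_nonneg (sq_nonneg lam) hg
  rw [mipObjective, ← Finset.sum_add_distrib]
  linarith

/-- The number of ancestors is a layering of a DAG. -/
theorem IsDAG.exists_layering {E : Finset (Fin p × Fin p)} (hE : IsDAG E) :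
    ∃ ψ : Fin p → ℝ, (∀ j, 1 ≤ ψ j ∧ ψ j ≤ p) ∧ ∀ k j, (k, j) ∈ E → ψ k + 1 ≤ ψ j := by
  classical
  let anc : Fin p → Finset (Fin p) := fun j =>
    Finset.univ.filter fun k => Relation.TransGen (fun k j => (k, j) ∈ E) k j
  have hanc : ∀ k j, k ∈ anc j ↔ Relation.TransGen (fun k j => (k, j) ∈ E) k j := by
    simp [anc]
  have hself : ∀ j, j ∉ anc j := fun j hj => hE j ((hanc j j).1 hj)
  refine ⟨fun j => (anc j).card + 1, fun j => ⟨by simp, ?_⟩, fun k j hkj => ?_⟩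
  · have : (anc j).card < p := by
      simpa using Finset.card_lt_univ_of_notMem (hself j)
    have : ((anc j).card : ℝ) + 1 ≤ p := by exact_mod_cast this
    exact this
  · have hss : anc k ⊂ anc j := by
      refine Finset.ssubset_iff_of_subset (fun l hl => ?_) |>.2
        ⟨k, (hanc k j).2 (Relation.TransGen.single hkj), hself k⟩
      exact (hanc l j).2 (((hanc l k).1 hl).tail hkj)
    have := Finset.card_lt_card hss
    have : ((anc k).card : ℝ) + 1 ≤ (anc j).card := by exact_mod_cast this
    linarith

/-- The truncated true model is feasible for the mixed-integer program. -/
theorem Regular.exists_mip_feasible (h : Regular m b S K C η) {s M lam : ℝ}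
    (hs : (m.E.card : ℝ) ≤ s) {β : ℕ → Fin p → Fin p → ℝ} (hβ : IsTrueCoef m b C η β)
    (hM : ∀ j c, |gammaOf m.σ
      (fun j => ∑ k, intercept b m.P (fun (r : Fin R) k j => β r k j) k j)
      (fun (r : Fin R) k j => β r k j) j c| ≤ M) (x : Fin n → Fin p → ℝ) :
    ∃ q : MIPPoint p R, MIPFeasible C η S s M q ∧ mipObjective b lam x q =
      ∑ j, Real.log (m.σ j ^ 2) +
        ∑ j, empResidual b m.P x (fun (r : Fin R) k j => β r k j) j 0 / m.σ j ^ 2 +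
          lam ^ 2 * m.E.card := by
  classical
  obtain ⟨ψ, hψ, hψE⟩ := m.isDAG.exists_layering
  set β' : Fin R → Fin p → Fin p → ℝ := fun r k j => β r k j with hβ'
  set β₀ : Fin p → ℝ := fun j => ∑ k, intercept b m.P β' k j with hβ₀
  set Γ := gammaOf m.σ β₀ β' with hΓ
  have hσ := m.σ_pos
  have hloop : ∀ j, (j, j) ∉ m.E := fun j hj => h.loopless j (h.subset hj)
  have hX : ∀ j, Γ j (colX R j) = (m.σ j)⁻¹ := fun j => by simp [hΓ, gammaOf]
  have hOff : ∀ j k, k ≠ j → Γ j (colX R k) = 0 := fun j k hk => by simp [hΓ, gammaOf, hk]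
  have hB : ∀ j k (r : Fin R), Γ j (colB r k) = (m.σ j)⁻¹ * -β r k j := fun j k r => rfl
  have hB0 : ∀ j k, (k, j) ∉ m.E → ∀ r : Fin R, Γ j (colB r k) = 0 := fun j k hkj r => by
    rw [hB, hβ.2 k j hkj, neg_zero, mul_zero]
  have hOne : ∀ j, Γ j (colOne p R) = (m.σ j)⁻¹ * -β₀ j := fun j => rfl
  have hpos : ∀ j, 0 < Γ j (colX R j) := fun j => by rw [hX]; exact inv_pos.2 (hσ j)
  have hbeta : betaOf Γ = β' := by
    funext r k j
    rw [betaOf, hX, hB]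
    have := (hσ j).ne'
    simp only [hβ']
    field_simp
  have hinteg : ∀ k j, (k, j) ∉ m.E → intercept b m.P β' k j = 0 := fun k j hkj => by
    simp [intercept, hβ', hβ.2 k j hkj]
  let q : MIPPoint p R := ⟨Γ, fun k j => if (k, j) ∈ m.E then 1 else 0, ψ⟩
  have hcol : ∀ j, ∑ k, q.g k j = (parents m.E j).card := fun j => by
    simp [q, parents, Finset.sum_boole]
  have htot : ∑ k, ∑ j, q.g k j = m.E.card := by
    rw [Finset.sum_comm]
    simp_rw [hcol]
    exact_mod_cast sum_card_parents m.E
  have hd : ∀ j, Γ j (colOne p R) / Γ j (colX R j) +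
      ∑ k ∈ Finset.univ.erase j, intercept b m.P (betaOf Γ) k j = 0 := fun j => by
    have e : ∑ k ∈ Finset.univ.erase j, intercept b m.P β' k j = β₀ j := by
      rw [hβ₀]
      simp only
      rw [← Finset.add_sum_erase _ _ (Finset.mem_univ j), hinteg j j (hloop j), zero_add]
    have := (hσ j).ne'
    rw [hbeta, e, hOne, hX]
    field_simp
    ring
  refine ⟨q, ?_, ?_⟩
  · refine
      { g_binary := fun k j => ?_
        g_diag := fun j => if_neg (hloop j)
        ψ_range := hψ
        Γ_offdiag := hOff
        Γ_self := fun j r => hB0 j j (hloop j) r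
        bigM_coef := fun k j _ r => ?_
        bigM_intercept := fun j => ?_
        bigM_diag := fun j => ⟨hpos j, (le_abs_self _).trans (hM j (colX R j))⟩
        layer := fun k j _ => ?_
        super := fun k j hkj => ?_
        card_le := htot.trans_le hs
        coef := ?_ }
    · by_cases hkj : (k, j) ∈ m.E
      · exact Or.inr (if_pos hkj)
      · exact Or.inl (if_neg hkj)
    · by_cases hkj : (k, j) ∈ m.E
      · have hMr := abs_le.1 (hM j (colB r k))
        simp only [q, hkj, if_true, mul_one]
        exact hMr
      · simp only [q, hkj, if_false, mul_zero]
        rw [hB0 j k hkj r]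
        simp
    · rw [hcol]
      -- Without parents the constraint forces a zero intercept, which holds because all functions
      -- into `j` vanish. With a parent, the sum of indicators is at least `1` and the bound `M`
      -- suffices.
      rcases (parents m.E j).eq_empty_or_nonempty with he | hne
      · have : β₀ j = 0 := Finset.sum_eq_zero fun k _ => hinteg k j fun hkj => by
          have := mem_parents.2 hkj
          rw [he] at this
          exact absurd this (Finset.notMem_empty k)
        simp only [q]
        rw [hOne, this, he]
        simp
      · have hMr := hM j (colOne p R)
        have hM0 : 0 ≤ M := (abs_nonneg _).trans hMr
        have h1 : (1 : ℝ) ≤ (parents m.E j).card := by exact_mod_cast hne.card_pos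
        have h2 : M ≤ M * (parents m.E j).card := le_mul_of_one_le_right hM0 h1
        have h3 := abs_le.1 hMr
        exact ⟨by rw [neg_mul]; exact (neg_le_neg h2).trans h3.1, h3.2.trans h2⟩
    · by_cases hkj : (k, j) ∈ m.E
      · simp only [q, hkj, if_true]
        linarith [hψE k j hkj]
      · simp only [q, hkj, if_false]
        -- For a non-edge the layer constraint is only `1 - p ≤ ψ_j - ψ_k`, which follows from the
        -- range of `ψ`.
        linarith [(hψ j).1, (hψ k).2]
    · have hkj' : (k, j) ∉ m.E := fun h' => hkj (h.subset h')
      exact ⟨if_neg hkj', fun r => hB0 j k hkj' r⟩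
    · change CoefBound C η (betaOf Γ)
      rw [hbeta]
      exact hβ.coefBound h.nonneg
  · rw [mipObjective, htot]
    congr 2
    · refine Finset.sum_congr rfl fun j _ => ?_
      simp only [q]
      rw [hX, Real.log_inv, Real.log_pow]
      push_cast; ring
    · refine Finset.sum_congr rfl fun j _ => ?_
      simp only [q]
      rw [dotProduct_gram_eq (P := m.P) x Γ j (hOff j) (fun r => hB0 j j (hloop j) r) (hpos j),
        hd, hbeta, hX, inv_pow, inv_mul_eq_div]

end Objective

/-! ### The good event and the asymptotics -/

section Asymptotics

/-- The constant in front of `√(log p / n)` in the uniform deviation bound. -/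
noncomputable def devConst (σbar : ℝ) : ℝ :=
  2 * (2 * (Real.exp (1 / σbar ^ 2) * Real.sqrt 2) + 8) / (1 / (8 * σbar ^ 2))

theorem devConst_nonneg (σbar : ℝ) : 0 ≤ devConst σbar := by
  unfold devConst; positivity

/-- With `L = log p` the geometric ratio is `p⁻⁴`; the `p` nodes and `p + 2` kinds of features then
leave a failure probability far below `4 / p`. -/
theorem Regular.le_measureReal_goodSamples {n p K : ℕ} {m : CausalAdditiveModel p}
    {b : ℕ → Fin p → Fin p → ℝ → ℝ} {S : Finset (Fin p × Fin p)} {C η σbar : ℝ}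
    (h : Regular m b S K C η) (hσ : ∀ j, m.σ j ^ 2 ≤ σbar ^ 2) (hn : 0 < n) (hp : 5 ≤ p)
    (hpn : Real.sqrt (Real.log p / n) ≤ 1) :
    1 - 4 / (p : ℝ) ≤ (Measure.pi fun _ : Fin n => m.P).real
      (goodSamples m.P n (feature m b) (devConst σbar * Real.sqrt (Real.log p / n))) := by
  have := m.isProb
  have hn' : (0 : ℝ) < n := Nat.cast_pos.2 hn
  have hp' : (5 : ℝ) ≤ p := by exact_mod_cast hp
  have hp0 : (0 : ℝ) < p := by linarith
  have hL : 1 ≤ Real.log p := by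
    rw [Real.le_log_iff_exp_le hp0]
    linarith [Real.exp_one_lt_d9]
  have hLn : Real.log p ≤ n := by
    rw [Real.sqrt_le_one] at hpn
    exact (div_le_one hn').1 hpn
  have hbar : 0 < σbar ^ 2 := by
    have h0 := m.σ_pos ⟨0, by omega⟩
    exact (pow_pos h0 2).trans_le (hσ _)
  have hmeas := fun j a => measurable_feature h.identifiable h.basis j a
  have hbound := measureReal_compl_goodSamples_le (P := m.P) hn hmeas
    (abs_feature_mul_le h.basis) (t₀ := 1 / (8 * σbar ^ 2)) (by positivity)
    (fun j => (h.identifiable.exp_envelope j (hσ j)).1)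
    (fun j => (h.identifiable.exp_envelope j (hσ j)).2) hL hLn
  change (Measure.pi fun _ : Fin n => m.P).real
    (goodSamples m.P n (feature m b) (devConst σbar * Real.sqrt (Real.log p / n)))ᶜ ≤ _ at hbound
  rw [probReal_compl_eq_one_sub (measurableSet_goodSamples hmeas _)] at hbound
  have hexp : Real.exp (-(4 * Real.log p)) = ((p : ℝ) ^ 4)⁻¹ := by
    rw [Real.exp_neg, show (4 : ℝ) * Real.log p = ((4 : ℕ) : ℝ) * Real.log p by norm_num,
      Real.exp_nat_mul, Real.exp_log hp0]
  rw [hexp] at hbound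
  simp only [Fintype.card_fin, Fintype.card_option] at hbound
  push_cast at hbound
  have hfin : 2 * (p : ℝ) * (2 * (p + 1 + 1) * ((p : ℝ) ^ 4)⁻¹) ^ 2 ≤ 4 / p := by
    have e : 2 * (p : ℝ) * (2 * (p + 1 + 1) * ((p : ℝ) ^ 4)⁻¹) ^ 2 =
        (4 / p) * (2 * (p + 2) ^ 2 / p ^ 6) := by field_simp; ring
    rw [e]
    refine mul_le_of_le_one_right (by positivity) ?_
    rw [div_le_one (by positivity)]
    have h1 : 2 * ((p : ℝ) + 2) ^ 2 ≤ p ^ 4 := by nlinarith [sq_nonneg ((p : ℝ) ^ 2 - 25)]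
    have h2 : (p : ℝ) ^ 4 ≤ p ^ 6 := pow_le_pow_right₀ (by linarith) (by norm_num)
    linarith
  linarith

/-- A true edge makes some ordering wrong, so the minimum defining the separation is not over the
empty set and the separation condition has content. -/
theorem exists_notMem_consistentPerms {p : ℕ} {E : Finset (Fin p × Fin p)} (hE : E.Nonempty)
    (hloop : ∀ j, (j, j) ∉ E) : ∃ π, π ∉ consistentPerms E := by
  obtain ⟨⟨k, j⟩, hkj⟩ := hE
  rcases lt_trichotomy k j with h | h | h
  · exact ⟨Equiv.swap k j, fun hπ => lt_asymm h (hπ j k (by simpa using hkj))⟩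
  · exact absurd (h ▸ hkj) (hloop j)
  · exact ⟨1, fun hπ => lt_asymm h (hπ k j (by simpa using hkj))⟩

theorem consistentPerms_empty {p : ℕ} :
    consistentPerms (∅ : Finset (Fin p × Fin p)) = Set.univ := by
  simp [consistentPerms]

/-- A sequence that is negligible compared with `p ξ_p` is negligible compared with the gaps of all
wrong orderings, uniformly. -/
theorem IsLittleOExt.eventually_le_orderGap {p : ℕ → ℕ} {C η : ℝ}
    {m : ∀ n, CausalAdditiveModel (p n)} {b : ∀ n, ℕ → Fin (p n) → Fin (p n) → ℝ → ℝ}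
    {S : ∀ n, Finset (Fin (p n) × Fin (p n))} {a : ℕ → ℝ}
    (ha : IsLittleOExt a fun n => (p n : EReal) * separation (m n) (b n) C η (S n)) {c : ℝ}
    (hc : 0 < c) : ∀ᶠ n in atTop, ∀ π, π ∉ consistentPerms (m n).E →
      |a n| ≤ c * orderGap (m n) (b n) (S n) C η π := by
  filter_upwards [ha c hc] with n hn π hπ
  -- With no nodes every permutation is vacuously consistent, so a wrong one forces `p ≠ 0` and the
  -- factor `p⁻¹` in the separation cancels.
  have hp : (p n : ℝ) ≠ 0 := by
    intro h0
    have h0' : p n = 0 := by exact_mod_cast h0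
    refine hπ fun i => ?_
    have hi := i.2
    omega
  have hsep : separation (m n) (b n) C η (S n) ≤
      (((p n : ℝ)⁻¹ * orderGap (m n) (b n) (S n) C η π : ℝ) : EReal) :=
    iInf_le (fun π : {π : Equiv.Perm (Fin (p n)) // π ∉ consistentPerms (m n).E} =>
      (((p n : ℝ)⁻¹ * orderGap (m n) (b n) (S n) C η π.1 : ℝ) : EReal)) ⟨π, hπ⟩
  have h1 : (c : EReal) * ((p n : EReal) * separation (m n) (b n) C η (S n)) ≤
      ((c * (p n * ((p n : ℝ)⁻¹ * orderGap (m n) (b n) (S n) C η π)) : ℝ) : EReal) := by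
    rw [EReal.coe_mul, EReal.coe_mul]
    refine mul_le_mul_of_nonneg_left ?_ (by exact_mod_cast hc.le)
    exact mul_le_mul_of_nonneg_left hsep (by positivity)
  have h2 := hn.trans h1
  rw [EReal.coe_le_coe_iff, mul_inv_cancel_left₀ hp] at h2
  exact h2

/-- Residual variances lie between positive constants, so every gap is of order at most `p`. The
separation condition thereby forces `√(log p / n)` to be small. -/
theorem Regular.orderGap_le_const {p K : ℕ} {m : CausalAdditiveModel p}
    {b : ℕ → Fin p → Fin p → ℝ → ℝ} {S : Finset (Fin p × Fin p)} {C η σbar cmin : ℝ}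
    (h : Regular m b S K C η) (hσ : ∀ j, m.σ j ^ 2 ≤ σbar ^ 2) (hcmin : 0 < cmin)
    (hν : ∀ j, ∀ g ⊆ parents S j, cmin ≤ residualVar b m.P C η j g) (π : Equiv.Perm (Fin p)) :
    orderGap m b S C η π ≤
      p * (Real.log ((1 + 2 * (K * C)) ^ 2 * (8 + 2 * σbar ^ 2)) - Real.log cmin) := by
  rw [orderGap, ← nsmul_eq_mul]
  have := Finset.sum_le_card_nsmul Finset.univ
    (fun j => Real.log (residualVar b m.P C η j (precedingParents S π j)) - Real.log (m.σ j ^ 2))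
    (Real.log ((1 + 2 * (K * C)) ^ 2 * (8 + 2 * σbar ^ 2)) - Real.log cmin) fun j _ => ?_
  · simpa using this
  · have hsub := precedingParents_subset S π j
    have h1 := hν j _ hsub
    refine sub_le_sub (Real.log_le_log (by linarith) (h.residualVar_le_const _ (hσ j) hsub))
      (Real.log_le_log hcmin ?_)
    exact (hν j _ (h.parents_subset j)).trans (h.residualVar_parents_le j)

/-- When the error terms are negligible compared with the gap of an ordering, the basic inequality
fails for it. -/
theorem Regular.not_orderGap_le {p K R : ℕ} {m : CausalAdditiveModel p}
    {b : ℕ → Fin p → Fin p → ℝ → ℝ} {S : Finset (Fin p × Fin p)} {C η cmin κ α s lam τ : ℝ}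
    (h : Regular m b S K C η) (hκ : 0 ≤ κ) (hα0 : 0 < α) (hα1 : α ≤ 1) (hp : 0 < p)
    (hcmin : 0 < cmin) (hs : 0 ≤ s) {π : Equiv.Perm (Fin p)}
    (hsmall : |lam ^ 2 * s + p * α + s * (R : ℝ) ^ (-2 * η)| ≤
      (4 * (3 * (κ + κ ^ 2) * (1 + 2 * (K * C)) ^ 2 / cmin + K * (2 * C) ^ 2 / cmin + 1))⁻¹ *
        orderGap m b S C η π)
    (hτ : |τ| ≤ 4⁻¹ * orderGap m b S C η π) :
    ¬ orderGap m b S C η π ≤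
      3 * (κ * α + (κ * α) ^ 2) * (1 + 2 * (K * C)) ^ 2 / cmin * p +
      K * (2 * C) ^ 2 / cmin * (s * (R : ℝ) ^ (-2 * η)) + lam ^ 2 * s + τ := by
  intro hle
  have hC := h.nonneg
  set c₁ := 3 * (κ + κ ^ 2) * (1 + 2 * (K * C)) ^ 2 / cmin with hc₁
  set c₂ := K * (2 * C) ^ 2 / cmin with hc₂
  have hc₁0 : 0 ≤ c₁ := by positivity
  have hc₂0 : 0 ≤ c₂ := by positivity
  have hp' : (0 : ℝ) < p := Nat.cast_pos.2 hp
  have hsR : 0 ≤ s * (R : ℝ) ^ (-2 * η) := by positivity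
  have hls : 0 ≤ lam ^ 2 * s := by positivity
  -- Strict positivity is essential: through `hsmall` it makes the gap strictly positive. The basic
  -- inequality would give gap at most gap/4 from the errors plus gap/4 from `τ`, a contradiction.
  have hpα : 0 < p * α := by positivity
  rw [abs_of_nonneg (by positivity), inv_mul_eq_div, le_div_iff₀ (by positivity)] at hsmall
  have h1 : 3 * (κ * α + (κ * α) ^ 2) * (1 + 2 * (K * C)) ^ 2 / cmin * p ≤ c₁ * (p * α) := by
    -- The quadratic deviation term is absorbed into the linear one because `α ≤ 1`.
    have h2 : κ * α + (κ * α) ^ 2 ≤ (κ + κ ^ 2) * α := by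
      nlinarith [mul_nonneg (sq_nonneg κ) (mul_nonneg hα0.le (sub_nonneg.2 hα1))]
    calc _ ≤ 3 * ((κ + κ ^ 2) * α) * (1 + 2 * (K * C)) ^ 2 / cmin * p := by gcongr
      _ = _ := by rw [hc₁]; ring
  have h3 := le_abs_self τ
  nlinarith [mul_nonneg hc₁0 hsR, mul_nonneg hc₁0 hls, mul_nonneg hc₂0 hpα.le,
    mul_nonneg hc₂0 hls]

/-- On good samples, early-stopped solutions of both problems have no wrong ordering. -/
theorem Regular.consistent_of_earlyStopped {p K n R : ℕ} {m : CausalAdditiveModel p}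
    {b : ℕ → Fin p → Fin p → ℝ → ℝ} {S : Finset (Fin p × Fin p)} {C η cmin κ α s lam τ : ℝ}
    (h : Regular m b S K C η) (hκ : 0 ≤ κ) (hα0 : 0 < α) (hα1 : α ≤ 1) (hp : 0 < p) (hn : 0 < n)
    (hR : 0 < R) (hcmin : 0 < cmin)
    (hν : ∀ j, ∀ g ⊆ parents S j, cmin ≤ residualVar b m.P C η j g)
    (hΔ : (κ * α + (κ * α) ^ 2) * (1 + 2 * (K * C)) ^ 2 ≤ cmin / 2) (hs : (m.E.card : ℝ) ≤ s)
    (hsmall : ∀ π, π ∉ consistentPerms m.E → |lam ^ 2 * s + p * α + s * (R : ℝ) ^ (-2 * η)| ≤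
      (4 * (3 * (κ + κ ^ 2) * (1 + 2 * (K * C)) ^ 2 / cmin + K * (2 * C) ^ 2 / cmin + 1))⁻¹ *
        orderGap m b S C η π)
    (hτ : ∀ π, π ∉ consistentPerms m.E → |τ| ≤ 4⁻¹ * orderGap m b S C η π)
    {x : Fin n → Fin p → ℝ} (hx : x ∈ goodSamples m.P n (feature m b) (κ * α)) :
    (∀ θ : MLEPoint p R,
      IsEarlyStopped (mleFeasible C η S s) (mleObjective b m.P lam x) τ θ →
        consistentPerms (coefGraph θ.β) ⊆ consistentPerms m.E) ∧
    (∀ M : ℝ, IsBigM m b C η R M → ∀ q : MIPPoint p R,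
      IsEarlyStopped {q | MIPFeasible C η S s M q} (mipObjective b lam x) τ q →
        consistentPerms (coefGraph (betaOf q.Γ)) ⊆ consistentPerms m.E) := by
  have hA : 0 ≤ κ * α := mul_nonneg hκ hα0.le
  have hs0 : 0 ≤ s := (Nat.cast_nonneg _).trans hs
  have hpos : ∀ (π : Equiv.Perm (Fin p)) j, 0 < residualVar b m.P C η j (precedingParents S π j) -
      (κ * α + (κ * α) ^ 2) * (1 + 2 * (K * C)) ^ 2 := fun π j => by
    linarith [hν j _ (precedingParents_subset S π j)]
  constructor
  · rintro θ ⟨hθ, L, hL, hθL⟩ π hπ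
    by_contra hπE
    obtain ⟨hσ, -, hbd, hsub, -⟩ := hθ
    obtain ⟨β, hβ⟩ := h.exists_isTrueCoef
    have hlow := fun j => h.residualVar_sub_le_empResidual hn hA hx hbd hsub hπ j 0
    have h1 := le_mleObjective (lam := lam) hσ fun j => (hpos π j).trans_le (hlow j)
    have h2 := hL _ (h.exists_mle_feasible (R := R) hs hβ)
    rw [mleObjective_eq] at h2
    -- Truncation may annihilate a true edge, so the truncated model has at most as many edges as
    -- the true graph.
    have h3 : lam ^ 2 * ((coefGraph fun (r : Fin R) k j => β r k j).card : ℝ) ≤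
        lam ^ 2 * m.E.card := by
      gcongr; exact hβ.coefGraph_subset
    exact h.not_orderGap_le hκ hα0 hα1 hp hcmin hs0 (hsmall π hπE) (hτ π hπE)
      (h.orderGap_le hA hx hR hcmin hν hΔ hs hβ hlow (by linarith))
  · rintro M ⟨β, hβ1, hβ2, hM⟩ q ⟨hq, L, hL, hqL⟩ π hπ
    by_contra hπE
    have hβ : IsTrueCoef m b C η β := ⟨hβ1, hβ2⟩
    have hq : MIPFeasible C η S s M q := hq
    have hlow := fun j => h.residualVar_sub_le_empResidual hn hA hx hq.coef hq.coefGraph_subset hπ j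
      (q.Γ j (colOne p R) / q.Γ j (colX R j) +
        ∑ k ∈ Finset.univ.erase j, intercept b m.P (betaOf q.Γ) k j)
    have h1 := hq.le_mipObjective (lam := lam) (fun _ => rfl)
      fun j => (hpos π j).trans_le (hlow j)
    obtain ⟨q', hq', hobj⟩ := h.exists_mip_feasible (lam := lam) hs hβ hM x
    have h2 := hL q' hq'
    exact h.not_orderGap_le hκ hα0 hα1 hp hcmin hs0 (hsmall π hπE) (hτ π hπE)
      (h.orderGap_le hA hx hR hcmin hν hΔ hs hβ hlow (by linarith))

end Asymptotics

end CausalAdditive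

/-! ### Assembly: choice of the events and passage to the limit -/

theorem theorem1
    -- number of nodes, number of basis functions, edge bound, penalty, at sample size `n`
    (p R : ℕ → ℕ) (s lam : ℕ → ℝ)
    -- constants that do not depend on `n`
    (K : ℕ) (C η σbar cmin : ℝ)
    -- true model, basis functions, super-structure at sample size `n`
    (m : ∀ n, CausalAdditiveModel (p n))
    (b : ∀ n, ℕ → Fin (p n) → Fin (p n) → ℝ → ℝ)
    (S : ∀ n, Finset (Fin (p n) × Fin (p n)))
    (hR : ∀ n, 0 < R n)
    -- identifiability conditions
    (hid : ∀ n, (m n).Identifiable)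
    -- super-structure: no self-loops, contains the true graph, at most `K` parents per node
    (hS_loop : ∀ n j, (j, j) ∉ S n)
    (hS_true : ∀ n, (m n).E ⊆ S n)
    (hS_sparse : ∀ n j, (parents (S n) j).card ≤ K)
    -- model sparsity
    (hs : ∀ n, ((m n).E.card : ℝ) ≤ s n)
    -- bounded orthogonal basis, decaying coefficients, true functions in the classes
    (hη : 1 < η)
    (hb : ∀ n, IsBoundedBasis (b n) (m n).P)
    (hf : ∀ n k j, k ≠ j → (m n).f k j ∈ classF (b n) (m n).P C η k j)
    -- bounded variances
    (hσ : ∀ n j, (m n).σ j ^ 2 ≤ σbar ^ 2)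
    (hcmin : 0 < cmin)
    (hν : ∀ n j, ∀ g ⊆ parents (S n) j, cmin ≤ residualVar (b n) (m n).P C η j g)
    -- functional compatibility
    (hφ : ∀ n, Compatible (b n) (m n).P C η)
    -- non-negligible separation
    (hξ : IsLittleOExt
      (fun n => lam n ^ 2 * s n + p n * Real.sqrt (Real.log (p n) / n)
        + s n * (R n : ℝ) ^ (-2 * η))
      (fun n => (p n : EReal) * separation (m n) (b n) C η (S n))) :
    ∃ A : ∀ n, Set (Fin n → Fin (p n) → ℝ),
      (∀ n, MeasurableSet (A n)) ∧
      (∀ᶠ n in atTop, 1 - 4 / (p n : ℝ) ≤ (Measure.pi fun _ : Fin n => (m n).P).real (A n)) ∧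
      -- (1) optimal solutions, for the penalized likelihood and for the mixed-integer program
      (∀ᶠ n in atTop, ∀ x ∈ A n,
        (∀ θ : MLEPoint (p n) (R n),
          IsOptimal (mleFeasible C η (S n) (s n)) (mleObjective (b n) (m n).P (lam n) x) θ →
            consistentPerms (coefGraph θ.β) ⊆ consistentPerms (m n).E) ∧
        (∀ M : ℝ, IsBigM (m n) (b n) C η (R n) M → ∀ q : MIPPoint (p n) (R n),
          IsOptimal {q | MIPFeasible C η (S n) (s n) M q} (mipObjective (b n) (lam n) x) q →
            consistentPerms (coefGraph (betaOf q.Γ)) ⊆ consistentPerms (m n).E)) ∧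
      -- (2) early-stopped solutions, on the same events
      (∀ τ : ℕ → ℝ,
        IsLittleOExt τ (fun n => (p n : EReal) * separation (m n) (b n) C η (S n)) →
        ∀ᶠ n in atTop, ∀ x ∈ A n,
          (∀ θ : MLEPoint (p n) (R n),
            IsEarlyStopped (mleFeasible C η (S n) (s n)) (mleObjective (b n) (m n).P (lam n) x)
              (τ n) θ →
              consistentPerms (coefGraph θ.β) ⊆ consistentPerms (m n).E) ∧
          (∀ M : ℝ, IsBigM (m n) (b n) C η (R n) M → ∀ q : MIPPoint (p n) (R n),
            IsEarlyStopped {q | MIPFeasible C η (S n) (s n) M q} (mipObjective (b n) (lam n) x)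
              (τ n) q →
              consistentPerms (coefGraph (betaOf q.Γ)) ⊆ consistentPerms (m n).E)) := by
  classical
  have hloop : ∀ n j, (j, j) ∉ (m n).E := fun n j hj => hS_loop n j (hS_true n hj)
  have hreg : ∀ n, (m n).E.Nonempty → Regular (m n) (b n) (S n) K C η := fun n hE =>
    { identifiable := hid n
      loopless := hS_loop n
      subset := hS_true n
      sparse := hS_sparse n
      one_lt := hη
      basis := hb n
      mem_classF := hf n
      nonneg := by
        -- Nonnegativity of `C` is read off from a function in some class, which needs a pair of
        -- distinct nodes; a true edge supplies one.
        obtain ⟨⟨k, j⟩, hkj⟩ := hE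
        have hne : k ≠ j := by rintro rfl; exact hloop n k hkj
        obtain ⟨β, hβ, -⟩ := hf n k j hne
        exact hβ.nonneg }
  set α : ℕ → ℝ := fun n => Real.sqrt (Real.log (p n) / n) with hα
  set κ := devConst σbar with hκdef
  have hκ : 0 ≤ κ := devConst_nonneg σbar
  have hcard : ∀ n, (m n).E.Nonempty → 2 ≤ p n := fun n hE => by
    obtain ⟨⟨k, j⟩, hkj⟩ := hE
    have hne : k ≠ j := by rintro rfl; exact hloop n k hkj
    have := Finset.card_le_univ ({k, j} : Finset (Fin (p n)))
    rwa [Finset.card_pair hne, Fintype.card_fin] at this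
  have hs0 : ∀ n, 0 ≤ s n := fun n => (Nat.cast_nonneg _).trans (hs n)
  -- For any wrong ordering, `p α` is at most a small multiple of its gap, and the gap is at most `p
  -- Λ`; dividing by `p` gives the claim. The `+ 1` in the denominators guards against `Λ = 0`.
  have hα_small : ∀ δ : ℝ, 0 < δ → ∀ᶠ n in atTop, (m n).E.Nonempty → α n ≤ δ := by
    intro δ hδ
    set Λ := Real.log ((1 + 2 * (K * C)) ^ 2 * (8 + 2 * σbar ^ 2)) - Real.log cmin with hΛ
    have hc : 0 < δ / (|Λ| + 1) := by positivity
    filter_upwards [hξ.eventually_le_orderGap hc] with n hn hE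
    obtain ⟨π, hπ⟩ := exists_notMem_consistentPerms hE (hloop n)
    have h1 := (le_abs_self _).trans (hn π hπ)
    have h2 := (hreg n hE).orderGap_le_const (hσ n) hcmin (hν n) π
    have hp : (0 : ℝ) < p n := Nat.cast_pos.2 (by have := hcard n hE; omega)
    have h3 : (p n : ℝ) * α n ≤ δ / (|Λ| + 1) * (p n * Λ) := by
      refine le_trans ?_ (h1.trans (mul_le_mul_of_nonneg_left h2 hc.le))
      have e1 : 0 ≤ lam n ^ 2 * s n := mul_nonneg (sq_nonneg _) (hs0 n)
      have e2 : 0 ≤ s n * (R n : ℝ) ^ (-2 * η) := mul_nonneg (hs0 n) (by positivity)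
      simp only [hα]
      linarith
    have h4 : α n ≤ δ / (|Λ| + 1) * Λ := by
      refine le_of_mul_le_mul_left ?_ hp
      linarith
    refine h4.trans ?_
    rw [div_mul_eq_mul_div, div_le_iff₀ (by positivity)]
    exact mul_le_mul_of_nonneg_left (by linarith [le_abs_self Λ]) hδ.le
  have hearly : ∀ τ : ℕ → ℝ,
      IsLittleOExt τ (fun n => (p n : EReal) * separation (m n) (b n) C η (S n)) →
      ∀ᶠ n in atTop, (m n).E.Nonempty →
        ∀ x ∈ goodSamples (m n).P n (feature (m n) (b n)) (κ * α n),
        (∀ θ : MLEPoint (p n) (R n),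
          IsEarlyStopped (mleFeasible C η (S n) (s n)) (mleObjective (b n) (m n).P (lam n) x)
            (τ n) θ →
            consistentPerms (coefGraph θ.β) ⊆ consistentPerms (m n).E) ∧
        (∀ M : ℝ, IsBigM (m n) (b n) C η (R n) M → ∀ q : MIPPoint (p n) (R n),
          IsEarlyStopped {q | MIPFeasible C η (S n) (s n) M q} (mipObjective (b n) (lam n) x)
            (τ n) q →
            consistentPerms (coefGraph (betaOf q.Γ)) ⊆ consistentPerms (m n).E) := by
    intro τ hτ
    -- Below this value of `α` the deviation `Δ` is at most `cmin / 2`, as the logarithmic estimate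
    -- requires.
    have hδ : 0 < cmin / (2 * ((κ + κ ^ 2) * (1 + 2 * (K * C)) ^ 2 + 1)) := by positivity
    have hc : 0 < (4 * (3 * (κ + κ ^ 2) * (1 + 2 * (K * C)) ^ 2 / cmin +
        K * (2 * C) ^ 2 / cmin + 1))⁻¹ := by positivity
    filter_upwards [hα_small 1 one_pos, hα_small _ hδ, hξ.eventually_le_orderGap hc,
      hτ.eventually_le_orderGap (show (0 : ℝ) < 4⁻¹ by norm_num), eventually_gt_atTop 0]
      with n h1 h2 h3 h4 hn hE x hx
    have hp2 := hcard n hE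
    have hn' : (0 : ℝ) < n := Nat.cast_pos.2 hn
    have hα0 : 0 < α n := by
      refine Real.sqrt_pos.2 (div_pos (Real.log_pos ?_) hn')
      exact_mod_cast hp2
    refine (hreg n hE).consistent_of_earlyStopped hκ hα0 (h1 hE) (by omega) hn (hR n) hcmin (hν n)
      ?_ (hs n) h3 h4 hx
    have h5 := h2 hE
    rw [le_div_iff₀ (by positivity)] at h5
    have h6 : κ * α n + (κ * α n) ^ 2 ≤ (κ + κ ^ 2) * α n := by
      nlinarith [mul_nonneg (sq_nonneg κ) (mul_nonneg hα0.le (sub_nonneg.2 (h1 hE)))]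
    have h7 := mul_le_mul_of_nonneg_right h6 (sq_nonneg (1 + 2 * (K * C)))
    linarith
  -- For an empty true graph the separation may be infinite without `log p / n` being small, so the
  -- concentration bound is unavailable. Every sample is then good, since all orderings are
  -- consistent.
  set A : ∀ n, Set (Fin n → Fin (p n) → ℝ) := fun n =>
    if (m n).E.Nonempty then goodSamples (m n).P n (feature (m n) (b n)) (κ * α n) else Set.univ
    with hAdef
  have hAearly : ∀ τ : ℕ → ℝ,
      IsLittleOExt τ (fun n => (p n : EReal) * separation (m n) (b n) C η (S n)) →
      ∀ᶠ n in atTop, ∀ x ∈ A n,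
        (∀ θ : MLEPoint (p n) (R n),
          IsEarlyStopped (mleFeasible C η (S n) (s n)) (mleObjective (b n) (m n).P (lam n) x)
            (τ n) θ →
            consistentPerms (coefGraph θ.β) ⊆ consistentPerms (m n).E) ∧
        (∀ M : ℝ, IsBigM (m n) (b n) C η (R n) M → ∀ q : MIPPoint (p n) (R n),
          IsEarlyStopped {q | MIPFeasible C η (S n) (s n) M q} (mipObjective (b n) (lam n) x)
            (τ n) q →
            consistentPerms (coefGraph (betaOf q.Γ)) ⊆ consistentPerms (m n).E) := by
    intro τ hτ
    filter_upwards [hearly τ hτ] with n hn x hx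
    by_cases hE : (m n).E.Nonempty
    · simp only [hAdef, hE, if_true] at hx
      exact hn hE x hx
    · rw [Finset.not_nonempty_iff_eq_empty.1 hE, consistentPerms_empty]
      exact ⟨fun _ _ => Set.subset_univ _, fun _ _ _ _ => Set.subset_univ _⟩
  refine ⟨A, fun n => ?_, ?_, ?_, hAearly⟩
  · by_cases hE : (m n).E.Nonempty
    · simp only [hAdef, hE, if_true]
      exact measurableSet_goodSamples (fun j a => measurable_feature (hid n) (hb n) j a) _
    · simp only [hAdef, hE, if_false]
      exact MeasurableSet.univ
  · filter_upwards [hα_small 1 one_pos, eventually_gt_atTop 0] with n h1 hn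
    have := (m n).isProb
    by_cases hE : (m n).E.Nonempty
    · simp only [hAdef, hE, if_true]
      rcases le_or_gt 5 (p n) with hp | hp
      · exact (hreg n hE).le_measureReal_goodSamples (hσ n) hn hp (h1 hE)
      -- For at most four nodes the bound `1 - 4/p` is not positive.
      · refine le_trans ?_ measureReal_nonneg
        have hp0 : (0 : ℝ) < p n := Nat.cast_pos.2 (by have := hcard n hE; omega)
        have hp4 : (p n : ℝ) ≤ 4 := by exact_mod_cast Nat.lt_succ_iff.1 hp
        rw [sub_nonpos, one_le_div hp0]
        exact hp4
    · simp only [hAdef, hE, if_false, probReal_univ]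
      have : 0 ≤ 4 / (p n : ℝ) := by positivity
      linarith
  · have h0 : IsLittleOExt (fun _ => 0)
        (fun n => (p n : EReal) * separation (m n) (b n) C η (S n)) := fun c hc => by
      filter_upwards [hξ c hc] with n hn
      refine le_trans ?_ hn
      rw [abs_zero]
      exact EReal.coe_le_coe_iff.2 (abs_nonneg _)
    filter_upwards [hAearly _ h0] with n hn x hx
    obtain ⟨h1, h2⟩ := hn x hx
    -- An optimal solution is early-stopped with threshold `0`, its own value being the lower bound.
    exact ⟨fun θ hθ => h1 θ ⟨hθ.1, _, hθ.2, by simp⟩,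
      fun M hM q hq => h2 M hM q ⟨hq.1, _, hq.2, by simp⟩⟩
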